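/- Let $b>0$ and $\gamma\ge 0$. All function spaces are real and carry the supremum norm. Let $A$ be the operator in $C[-b,b]$ given by $Af=\tfrac12 f''$ on the domain of all $f\in C[-b,b]$ that are twice continuously differentiable on $[-b,0]$ and on $[0,b]$ separately (one-sided derivatives at the ends) and satisfy $$f''(-b)=f''(b)=0,\qquad f''(0+)=f''(0-),\qquad f'(0+)-f'(0-)=2\gamma f(0).$$ Let $C_0(0,b]=\{f\in C[0,b]: f(0)=0\}$. Let $G_1$ be the operator in $C_0(0,b]$ given by $G_1f=\tfrac12 f''$ on the domain of all twice continuously differentiable $f$ on $[0,b]$ with $f(0)=f''(0)=f''(b)=0$. Let $G_2$ be the operator in $C[0,b]$ given by $G_2f=\tfrac12 f''$ on the domain of all twice continuously differentiable $f$ on $[0,b]$ with $f'(0)=\gamma f(0)$ and $f''(b)=0$. For $f\in C[-b,b]$ let $Q_1f(x)=\tfrac12(f(x)-f(-x))$ and $Q_2f(x)=\tfrac12(f(x)+f(-x))$ be its odd and even parts. Let $J_1$ be the isometric isomorphism from the odd functions in $C[-b,b]$ onto $C_0(0,b]$, and $J_2$ the one from the even functions in $C[-b,b]$ onto $C[0,b]$,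 both given by restriction to $[0,b]$. Then each of $A$, $G_1$, $G_2$ is the generator of a strongly continuous semigroup of bounded linear operators, and the semigroups that they generate satisfy $$e^{tA}=\sum_{i=1}^{2}J_i^{-1}\,e^{tG_i}\,J_i\,Q_i,\qquad t\ge 0.$$ -/

import Mathlib

open Set Filter Topology
open scoped NNReal

noncomputable section

namespace ElasticBM

/-! ### Strongly continuous semigroups and their generators -/

/-- A strongly continuous semigroup of bounded linear operators on a normed space `X`. -/
structure C0Semigroup (X : Type*) [NormedAddCommGroup X] [NormedSpace ℝ X] where
  toFun : ℝ≥0 → X →L[ℝ] X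
  map_zero' : toFun 0 = ContinuousLinearMap.id ℝ X
  map_add' : ∀ s t, toFun (s + t) = (toFun s).comp (toFun t)
  continuous' : ∀ x, Continuous fun t => toFun t x

instance {X : Type*} [NormedAddCommGroup X] [NormedSpace ℝ X] :
    CoeFun (C0Semigroup X) (fun _ => ℝ≥0 → X →L[ℝ] X) := ⟨C0Semigroup.toFun⟩

/-- `G` is the (infinitesimal) generator of `S`: the pair `(x, y)` is in the graph of `G` exactly
when `t⁻¹ (S t x - x) → y` as `t → 0+`. -/
def IsGenerator {X : Type*} [NormedAddCommGroup X] [NormedSpace ℝ X]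
    (G : X →ₗ.[ℝ] X) (S : C0Semigroup X) : Prop :=
  ∀ x y : X, (x, y) ∈ G.graph ↔
    Tendsto (fun t : ℝ≥0 => (t : ℝ)⁻¹ • (S t x - x)) (𝓝[>] 0) (𝓝 y)

/-! ### Derivatives of continuous functions on an interval -/

/-- A function on `[a, b]` as a function on the line (constant outside `[a, b]`); it is only ever
differentiated within subintervals of `[a, b]`. -/
def lineExt {a b : ℝ} (h : a ≤ b) (f : C(Icc a b, ℝ)) : ℝ → ℝ := IccExtend h f

lemma lineExt_add {a b : ℝ} (h : a ≤ b) (f g : C(Icc a b, ℝ)) :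
    lineExt h (f + g) = lineExt h f + lineExt h g := rfl

lemma lineExt_smul {a b : ℝ} (h : a ≤ b) (c : ℝ) (f : C(Icc a b, ℝ)) :
    lineExt h (c • f) = c • lineExt h f := rfl

lemma lineExt_zero {a b : ℝ} (h : a ≤ b) : lineExt h (0 : C(Icc a b, ℝ)) = 0 := rfl

/-- The derivative of `F` at `x`, within `[c, d]` (one-sided at the ends). -/
abbrev D1 (c d : ℝ) (F : ℝ → ℝ) (x : ℝ) : ℝ := derivWithin F (Icc c d) x

/-- The second derivative of `F` at `x`, within `[c, d]` (one-sided at the ends). -/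
abbrev D2 (c d : ℝ) (F : ℝ → ℝ) (x : ℝ) : ℝ := iteratedDerivWithin 2 F (Icc c d) x


lemma D1_add {c d : ℝ} {F G : ℝ → ℝ} (hF : ContDiffOn ℝ 2 F (Icc c d))
    (hG : ContDiffOn ℝ 2 G (Icc c d)) {x : ℝ} (hx : x ∈ Icc c d) :
    D1 c d (F + G) x = D1 c d F x + D1 c d G x :=
  derivWithin_add (hF.differentiableOn (by norm_num) x hx)
    (hG.differentiableOn (by norm_num) x hx)

lemma D1_smul {c d : ℝ} {F : ℝ → ℝ} (k : ℝ) {x : ℝ} : D1 c d (k • F) x = k * D1 c d F x := by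
  simp [D1, derivWithin_const_smul_field]

lemma D2_add {c d : ℝ} (hcd : c < d) {F G : ℝ → ℝ} (hF : ContDiffOn ℝ 2 F (Icc c d))
    (hG : ContDiffOn ℝ 2 G (Icc c d)) {x : ℝ} (hx : x ∈ Icc c d) :
    D2 c d (F + G) x = D2 c d F x + D2 c d G x :=
  iteratedDerivWithin_add hx (uniqueDiffOn_Icc hcd) (hF x hx) (hG x hx)

lemma D2_smul {c d : ℝ} (hcd : c < d) {F : ℝ → ℝ} (k : ℝ) (hF : ContDiffOn ℝ 2 F (Icc c d))
    {x : ℝ} (hx : x ∈ Icc c d) : D2 c d (k • F) x = k * D2 c d F x :=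
  iteratedDerivWithin_const_smul hx (uniqueDiffOn_Icc hcd) k (hF x hx)

lemma D1_zero {c d x : ℝ} : D1 c d 0 x = 0 := by simp [D1]

lemma D2_zero {c d x : ℝ} : D2 c d 0 x = 0 := by simp [D2]

lemma D2_cont {c d : ℝ} (hcd : c < d) {F : ℝ → ℝ} (hF : ContDiffOn ℝ 2 F (Icc c d)) :
    ContinuousOn (D2 c d F) (Icc c d) :=
  hF.continuousOn_iteratedDerivWithin le_rfl (uniqueDiffOn_Icc hcd)

/-! ### The operator `A` on `C[a, b]`, where `a < 0 < b` -/

/-- The domain of `A`: functions in `C[a, b]` that are twice continuously differentiable on `[a, 0]`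
and on `[0, b]` separately, with `f''(a) = f''(b) = 0`, `f''(0+) = f''(0-)` and
`f'(0+) - f'(0-) = 2 γ f(0)`. -/
def domA (a b γ : ℝ) (ha : a < 0) (hb : 0 < b) : Submodule ℝ C(Icc a b, ℝ) where
  carrier := {f | ContDiffOn ℝ 2 (lineExt (ha.trans hb).le f) (Icc a 0) ∧
    ContDiffOn ℝ 2 (lineExt (ha.trans hb).le f) (Icc 0 b) ∧
    D2 a 0 (lineExt (ha.trans hb).le f) a = 0 ∧
    D2 0 b (lineExt (ha.trans hb).le f) b = 0 ∧
    D2 0 b (lineExt (ha.trans hb).le f) 0 = D2 a 0 (lineExt (ha.trans hb).le f) 0 ∧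
    D1 0 b (lineExt (ha.trans hb).le f) 0 - D1 a 0 (lineExt (ha.trans hb).le f) 0
      = 2 * γ * f ⟨0, ha.le, hb.le⟩}
  zero_mem' := by
    simp only [mem_ofPred_eq, lineExt_zero, D2_zero, D1_zero]
    refine ⟨contDiffOn_const, contDiffOn_const, trivial, trivial, trivial, by simp⟩
  add_mem' := by
    rintro f g ⟨f1, f2, f3, f4, f5, f6⟩ ⟨g1, g2, g3, g4, g5, g6⟩
    simp only [mem_ofPred_eq, lineExt_add]
    refine ⟨f1.add g1, f2.add g2, ?_, ?_, ?_, ?_⟩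
    · rw [D2_add ha f1 g1 (left_mem_Icc.2 ha.le), f3, g3, add_zero]
    · rw [D2_add hb f2 g2 (right_mem_Icc.2 hb.le), f4, g4, add_zero]
    · rw [D2_add hb f2 g2 (left_mem_Icc.2 hb.le), D2_add ha f1 g1 (right_mem_Icc.2 ha.le), f5, g5]
    · rw [D1_add f2 g2 (left_mem_Icc.2 hb.le), D1_add f1 g1 (right_mem_Icc.2 ha.le),
        ContinuousMap.add_apply]
      linarith
  smul_mem' := by
    rintro k f ⟨f1, f2, f3, f4, f5, f6⟩
    simp only [mem_ofPred_eq, lineExt_smul]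
    refine ⟨f1.const_smul k, f2.const_smul k, ?_, ?_, ?_, ?_⟩
    · rw [D2_smul ha k f1 (left_mem_Icc.2 ha.le), f3, mul_zero]
    · rw [D2_smul hb k f2 (right_mem_Icc.2 hb.le), f4, mul_zero]
    · rw [D2_smul hb k f2 (left_mem_Icc.2 hb.le), D2_smul ha k f1 (right_mem_Icc.2 ha.le), f5]
    · rw [D1_smul, D1_smul, ContinuousMap.smul_apply, ← mul_sub, f6, smul_eq_mul]
      ring

/-- The second derivative on `[a, b]` of a function that is twice differentiable on either side
of `0`, with equal one-sided second derivatives at `0`. -/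
def D2pw (a b : ℝ) (F : ℝ → ℝ) (x : ℝ) : ℝ := if x ≤ 0 then D2 a 0 F x else D2 0 b F x

lemma D2pw_cont {a b : ℝ} (ha : a < 0) (hb : 0 < b) {F : ℝ → ℝ}
    (h1 : ContDiffOn ℝ 2 F (Icc a 0)) (h2 : ContDiffOn ℝ 2 F (Icc 0 b))
    (h : D2 0 b F 0 = D2 a 0 F 0) : ContinuousOn (D2pw a b F) (Icc a b) := by
  rw [← Icc_union_Icc_eq_Icc ha.le hb.le]
  refine ContinuousOn.union_of_isClosed ?_ ?_ isClosed_Icc isClosed_Icc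
  · exact (D2_cont ha h1).congr fun x hx => by simp [D2pw, hx.2]
  · refine (D2_cont hb h2).congr fun x hx => ?_
    rcases hx.1.eq_or_lt with rfl | h0
    · simp [D2pw, h]
    · simp [D2pw, not_le.2 h0]

/-- The operator `A f = ½ f''` on `domA`. -/
def opA (a b γ : ℝ) (ha : a < 0) (hb : 0 < b) : C(Icc a b, ℝ) →ₗ.[ℝ] C(Icc a b, ℝ) where
  domain := domA a b γ ha hb
  toFun :=
    { toFun := fun f =>
        ⟨fun x => (1 / 2) * D2pw a b (lineExt (ha.trans hb).le f.1) x,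
          continuous_const.mul
            (D2pw_cont ha hb f.2.1 f.2.2.1 f.2.2.2.2.2.1).domRestrict⟩
      map_add' := by
        intro f g
        ext x
        simp only [Submodule.coe_add, lineExt_add, ContinuousMap.coe_mk, ContinuousMap.add_apply, D2pw]
        split_ifs with hx
        · rw [D2_add ha f.2.1 g.2.1 ⟨x.2.1, hx⟩, mul_add]
        · rw [D2_add hb f.2.2.1 g.2.2.1 ⟨(not_le.1 hx).le, x.2.2⟩, mul_add]
      map_smul' := by
        intro k f
        ext x
        simp only [Submodule.coe_smul, lineExt_smul, ContinuousMap.coe_mk, ContinuousMap.smul_apply,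
          D2pw, RingHom.id_apply, smul_eq_mul]
        split_ifs with hx
        · rw [D2_smul ha k f.2.1 ⟨x.2.1, hx⟩]; ring
        · rw [D2_smul hb k f.2.2.1 ⟨(not_le.1 hx).le, x.2.2⟩]; ring }

/-! ### The operator `G₁` on `C₀(0, b]` and the operator `G₂` on `C[0, b]` -/

/-- The space `C₀(0, b]` of continuous functions on `[0, b]` that vanish at `0`. -/
def C0Ioc (b : ℝ) (hb : 0 < b) : Submodule ℝ C(Icc 0 b, ℝ) where
  carrier := {f | f ⟨0, le_rfl, hb.le⟩ = 0}
  zero_mem' := rfl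
  add_mem' := by
    intro f g hf hg
    simp only [mem_ofPred_eq, ContinuousMap.add_apply] at *
    rw [hf, hg, add_zero]
  smul_mem' := by
    intro k f hf
    simp only [mem_ofPred_eq, ContinuousMap.smul_apply] at *
    rw [hf, smul_zero]

/-- The domain of `G₁`: twice continuously differentiable functions on `[0, b]` with
`f(0) = 0` (built into the space `C₀(0, b]`) and `f''(0) = f''(b) = 0`. -/
def domG1 (b : ℝ) (hb : 0 < b) : Submodule ℝ (C0Ioc b hb) where
  carrier := {f | ContDiffOn ℝ 2 (lineExt hb.le f.1) (Icc 0 b) ∧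
    D2 0 b (lineExt hb.le f.1) 0 = 0 ∧ D2 0 b (lineExt hb.le f.1) b = 0}
  zero_mem' := by
    simp only [mem_ofPred_eq, ZeroMemClass.coe_zero, lineExt_zero, D2_zero]
    exact ⟨contDiffOn_const, trivial, trivial⟩
  add_mem' := by
    rintro f g ⟨f1, f2, f3⟩ ⟨g1, g2, g3⟩
    simp only [mem_ofPred_eq, Submodule.coe_add, lineExt_add]
    refine ⟨f1.add g1, ?_, ?_⟩
    · rw [D2_add hb f1 g1 (left_mem_Icc.2 hb.le), f2, g2, add_zero]
    · rw [D2_add hb f1 g1 (right_mem_Icc.2 hb.le), f3, g3, add_zero]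
  smul_mem' := by
    rintro k f ⟨f1, f2, f3⟩
    simp only [mem_ofPred_eq, Submodule.coe_smul, lineExt_smul]
    refine ⟨f1.const_smul k, ?_, ?_⟩
    · rw [D2_smul hb k f1 (left_mem_Icc.2 hb.le), f2, mul_zero]
    · rw [D2_smul hb k f1 (right_mem_Icc.2 hb.le), f3, mul_zero]

/-- The domain of `G₂`: twice continuously differentiable functions on `[0, b]` with
`f'(0) = γ f(0)` and `f''(b) = 0`. -/
def domG2 (b γ : ℝ) (hb : 0 < b) : Submodule ℝ C(Icc 0 b, ℝ) where
  carrier := {f | ContDiffOn ℝ 2 (lineExt hb.le f) (Icc 0 b) ∧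
    D1 0 b (lineExt hb.le f) 0 = γ * f ⟨0, le_rfl, hb.le⟩ ∧ D2 0 b (lineExt hb.le f) b = 0}
  zero_mem' := by
    simp only [mem_ofPred_eq, lineExt_zero, D2_zero, D1_zero]
    exact ⟨contDiffOn_const, by simp, trivial⟩
  add_mem' := by
    rintro f g ⟨f1, f2, f3⟩ ⟨g1, g2, g3⟩
    simp only [mem_ofPred_eq, lineExt_add]
    refine ⟨f1.add g1, ?_, ?_⟩
    · rw [D1_add f1 g1 (left_mem_Icc.2 hb.le), f2, g2, ContinuousMap.add_apply, mul_add]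
    · rw [D2_add hb f1 g1 (right_mem_Icc.2 hb.le), f3, g3, add_zero]
  smul_mem' := by
    rintro k f ⟨f1, f2, f3⟩
    simp only [mem_ofPred_eq, lineExt_smul]
    refine ⟨f1.const_smul k, ?_, ?_⟩
    · rw [D1_smul, f2, ContinuousMap.smul_apply, smul_eq_mul]; ring
    · rw [D2_smul hb k f1 (right_mem_Icc.2 hb.le), f3, mul_zero]

/-- The function `½ f''` on `[0, b]`. -/
def halfD2 (b : ℝ) (hb : 0 < b) (f : C(Icc 0 b, ℝ))
    (hf : ContDiffOn ℝ 2 (lineExt hb.le f) (Icc 0 b)) : C(Icc 0 b, ℝ) :=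
  ⟨fun x => (1 / 2) * D2 0 b (lineExt hb.le f) x, continuous_const.mul (D2_cont hb hf).domRestrict⟩

/-- The operator `G₁ f = ½ f''` in `C₀(0, b]` on `domG1`. -/
def opG1 (b : ℝ) (hb : 0 < b) : C0Ioc b hb →ₗ.[ℝ] C0Ioc b hb where
  domain := domG1 b hb
  toFun :=
    { toFun := fun f => ⟨halfD2 b hb f.1.1 f.2.1, by
        change (1 / 2) * D2 0 b (lineExt hb.le f.1.1) 0 = 0
        rw [f.2.2.1, mul_zero]⟩
      map_add' := by
        intro f g
        ext x
        change (1 / 2) * D2 0 b (lineExt hb.le f.1.1 + lineExt hb.le g.1.1) x =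
          (1 / 2) * D2 0 b (lineExt hb.le f.1.1) x + (1 / 2) * D2 0 b (lineExt hb.le g.1.1) x
        rw [D2_add hb f.2.1 g.2.1 x.2, mul_add]
      map_smul' := by
        intro k f
        ext x
        change (1 / 2) * D2 0 b (k • lineExt hb.le f.1.1) x =
          k * ((1 / 2) * D2 0 b (lineExt hb.le f.1.1) x)
        rw [D2_smul hb k f.2.1 x.2]
        ring }

/-- The operator `G₂ f = ½ f''` in `C[0, b]` on `domG2`. -/
def opG2 (b γ : ℝ) (hb : 0 < b) : C(Icc 0 b, ℝ) →ₗ.[ℝ] C(Icc 0 b, ℝ) where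
  domain := domG2 b γ hb
  toFun :=
    { toFun := fun f => halfD2 b hb f.1 f.2.1
      map_add' := by
        intro f g
        ext x
        change (1 / 2) * D2 0 b (lineExt hb.le f.1 + lineExt hb.le g.1) x =
          (1 / 2) * D2 0 b (lineExt hb.le f.1) x + (1 / 2) * D2 0 b (lineExt hb.le g.1) x
        rw [D2_add hb f.2.1 g.2.1 x.2, mul_add]
      map_smul' := by
        intro k f
        ext x
        change (1 / 2) * D2 0 b (k • lineExt hb.le f.1) x =
          k * ((1 / 2) * D2 0 b (lineExt hb.le f.1) x)
        rw [D2_smul hb k f.2.1 x.2]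
        ring }

/-! ### Odd and even parts -/

/-- The reflection `x ↦ -x` of `[-b, b]`. -/
def reflect (b : ℝ) : C(Icc (-b) b, Icc (-b) b) where
  toFun x := ⟨-x.1, neg_le_neg x.2.2, by linarith [x.2.1]⟩
  continuous_toFun := by fun_prop

lemma reflect_reflect (b : ℝ) (x : Icc (-b) b) : reflect b (reflect b x) = x :=
  Subtype.ext (neg_neg x.1)

/-- The subspace of odd functions in `C[-b, b]`. -/
def oddSub (b : ℝ) : Submodule ℝ C(Icc (-b) b, ℝ) where
  carrier := {f | ∀ x, f (reflect b x) = -f x}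
  zero_mem' := by intro x; simp
  add_mem' := by
    intro f g hf hg x
    rw [ContinuousMap.add_apply, hf x, hg x, ContinuousMap.add_apply, neg_add]
  smul_mem' := by
    intro k f hf x
    rw [ContinuousMap.smul_apply, hf x, ContinuousMap.smul_apply, smul_neg]

/-- The subspace of even functions in `C[-b, b]`. -/
def evenSub (b : ℝ) : Submodule ℝ C(Icc (-b) b, ℝ) where
  carrier := {f | ∀ x, f (reflect b x) = f x}
  zero_mem' := by intro x; simp
  add_mem' := by
    intro f g hf hg x
    rw [ContinuousMap.add_apply, hf x, hg x, ContinuousMap.add_apply]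
  smul_mem' := by
    intro k f hf x
    rw [ContinuousMap.smul_apply, hf x, ContinuousMap.smul_apply]

/-- `Q₁ f (x) = ½ (f x - f (-x))`, the odd part. -/
def Q1 (b : ℝ) : C(Icc (-b) b, ℝ) →ₗ[ℝ] oddSub b where
  toFun f := ⟨(1 / 2 : ℝ) • (f - f.comp (reflect b)), by
    intro x
    simp [reflect_reflect]
    ring⟩
  map_add' f g := by
    ext x
    simp
    ring
  map_smul' k f := by
    ext x
    simp
    ring

/-- `Q₂ f (x) = ½ (f x + f (-x))`, the even part. -/
def Q2 (b : ℝ) : C(Icc (-b) b, ℝ) →ₗ[ℝ] evenSub b where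
  toFun f := ⟨(1 / 2 : ℝ) • (f + f.comp (reflect b)), by
    intro x
    simp [reflect_reflect]
    ring⟩
  map_add' f g := by
    ext x
    simp
    ring
  map_smul' k f := by
    ext x
    simp
    ring

/-- The inclusion of `[0, b]` in `[-b, b]`. -/
def incl (b : ℝ) : C(Icc 0 b, Icc (-b) b) where
  toFun x := ⟨x.1, by linarith [x.2.1, x.2.2], x.2.2⟩
  continuous_toFun := by fun_prop

/-- The odd extension to `[-b, b]` of a function on `[0, b]` that vanishes at `0`:
`g x` for `0 ≤ x`, and `-g (-x)` for `x ≤ 0` (`projIcc` maps negative numbers to `0`). -/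
def oddExt (b : ℝ) (hb : 0 < b) (g : C(Icc 0 b, ℝ)) : C(Icc (-b) b, ℝ) where
  toFun x := g (projIcc 0 b hb.le x) - g (projIcc 0 b hb.le (-x))
  continuous_toFun := by
    have := continuous_projIcc (h := hb.le)
    fun_prop

/-- The absolute value, from `[-b, b]` to `[0, b]`. -/
def absI (b : ℝ) : C(Icc (-b) b, Icc 0 b) where
  toFun x := ⟨|x.1|, abs_nonneg _, abs_le.2 x.2⟩
  continuous_toFun := by fun_prop

/-- For `f` odd or even on `[-b, b]`, the absolute values of `f |x|` and `f x` agree. -/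
lemma abs_apply_absI {b : ℝ} (f : C(Icc (-b) b, ℝ))
    (hf : (∀ x, f (reflect b x) = -f x) ∨ (∀ x, f (reflect b x) = f x)) (x : Icc (-b) b) :
    ‖f (incl b (absI b x))‖ = ‖f x‖ := by
  rcases le_total 0 x.1 with h | h
  · have : incl b (absI b x) = x := Subtype.ext (abs_of_nonneg h)
    rw [this]
  · have : incl b (absI b x) = reflect b x := Subtype.ext (abs_of_nonpos h)
    rw [this]
    rcases hf with hf | hf
    · rw [hf, norm_neg]
    · rw [hf]

lemma norm_comp_incl {b : ℝ} (f : C(Icc (-b) b, ℝ))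
    (hf : (∀ x, f (reflect b x) = -f x) ∨ (∀ x, f (reflect b x) = f x)) :
    ‖f.comp (incl b)‖ = ‖f‖ := by
  apply le_antisymm
  · exact (ContinuousMap.norm_le _ (norm_nonneg _)).2 fun x => f.norm_coe_le_norm _
  · refine (ContinuousMap.norm_le _ (norm_nonneg _)).2 fun x => ?_
    rw [← abs_apply_absI f hf x]
    exact (f.comp (incl b)).norm_coe_le_norm (absI b x)

/-- The natural isometric isomorphism `J₁ f = f|_{[0, b]}` of the odd functions onto
`C₀(0, b]`. -/
def J1 (b : ℝ) (hb : 0 < b) : oddSub b ≃ₗᵢ[ℝ] C0Ioc b hb where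
  toFun f := ⟨f.1.comp (incl b), by
    have h := f.2 (incl b ⟨0, le_rfl, hb.le⟩)
    have h0 : reflect b (incl b ⟨0, le_rfl, hb.le⟩) = incl b ⟨0, le_rfl, hb.le⟩ :=
      Subtype.ext neg_zero
    rw [h0] at h
    change f.1 (incl b ⟨0, le_rfl, hb.le⟩) = 0
    linarith⟩
  map_add' f g := rfl
  map_smul' k f := rfl
  invFun g := ⟨oddExt b hb g.1, by
    intro x
    simp [oddExt, reflect]⟩
  left_inv f := by
    ext x
    change f.1 (incl b (projIcc 0 b hb.le x)) - f.1 (incl b (projIcc 0 b hb.le (-x))) = f.1 x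
    have h0 : f.1 (incl b ⟨0, le_rfl, hb.le⟩) = 0 := by
      have h := f.2 (incl b ⟨0, le_rfl, hb.le⟩)
      have e : reflect b (incl b ⟨0, le_rfl, hb.le⟩) = incl b ⟨0, le_rfl, hb.le⟩ :=
        Subtype.ext neg_zero
      rw [e] at h
      linarith
    rcases le_total 0 x.1 with h | h
    · rw [projIcc_of_le_left hb.le (neg_nonpos.2 h), projIcc_of_mem hb.le ⟨h, x.2.2⟩, h0, sub_zero]
      rfl
    · rw [projIcc_of_le_left hb.le h, projIcc_of_mem hb.le (x := -x.1)
        ⟨neg_nonneg.2 h, by linarith [x.2.1]⟩, h0, zero_sub, ← neg_eq_iff_eq_neg.2 (f.2 x)]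
      rfl
  right_inv g := by
    ext x
    change g.1 (projIcc 0 b hb.le x) - g.1 (projIcc 0 b hb.le (-x)) = g.1 x
    rw [projIcc_of_le_left hb.le (neg_nonpos.2 x.2.1), projIcc_val]
    have h0 : g.1 ⟨0, le_rfl, hb.le⟩ = 0 := g.2
    rw [h0, sub_zero]
  norm_map' f := by
    exact norm_comp_incl f.1 (Or.inl f.2)

/-- The natural isometric isomorphism `J₂ f = f|_{[0, b]}` of the even functions onto
`C[0, b]`. -/
def J2 (b : ℝ) : evenSub b ≃ₗᵢ[ℝ] C(Icc 0 b, ℝ) where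
  toFun f := f.1.comp (incl b)
  map_add' f g := rfl
  map_smul' k f := rfl
  invFun g := ⟨g.comp (absI b), by
    intro x
    simp [absI, reflect]⟩
  left_inv f := by
    ext x
    change f.1 (incl b (absI b x)) = f.1 x
    rcases le_total 0 x.1 with h | h
    · exact congrArg f.1 (Subtype.ext (abs_of_nonneg h))
    · rw [← f.2 x]
      exact congrArg f.1 (Subtype.ext (abs_of_nonpos h))
  right_inv g := by
    ext x
    exact congrArg g (Subtype.ext (abs_of_nonneg x.2.1))
  norm_map' f := by
    exact norm_comp_incl f.1 (Or.inr f.2)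

end ElasticBM

end

open ElasticBM

namespace ElasticBM

/-! ### Resolvents of m-dissipative operators and exponentials of bounded ones. -/

section HilleYosida

variable {X : Type*} [NormedAddCommGroup X] [NormedSpace ℝ X]

/-! Reflection decouples `A`. Split `f` into odd and even parts and restrict both to `[0, b]`. The
equality `f''(0+) = f''(0-)` says that the odd part has vanishing second derivative at `0`. The jump
condition says that the even part has slope `½ (f'(0+) - f'(0-)) = γ f(0)` there. Conversely, a
function in the domain of `G₁` and one in the domain of `G₂` glue to a function in the domain of
`A`. So `A` is the direct sum of `G₁` and `G₂` (`mem_graph_opA_iff`), and the direct sum of their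
semigroups is generated by `A` (`DirectSum₂.isGenerator_semigroup`).

Existence for `G₁` and `G₂` is the Hille-Yosida theorem (`IsMDissipative.exists_semigroup`), proved
by Yosida approximation. Its hypotheses are checked by a maximum principle
(`mul_norm_le_norm_smul_sub`), by solving the resolvent equation explicitly
(`exists_resolvent_solution`), and by correcting Weierstrass polynomials at the endpoints
(`dense_domG1`, `dense_domG2`).

The formula is claimed for all semigroups with these generators, so uniqueness is needed as well:
`IsGenerator.unique` compares an arbitrary semigroup with a uniformly bounded one, here the
constructed one. -/

/-- A densely defined dissipative operator `G` such that `l - G` is onto for all `l > 0`. -/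
structure IsMDissipative (G : X →ₗ.[ℝ] X) : Prop where
  dense_domain : Dense (G.domain : Set X)
  dissipative : ∀ l : ℝ, 0 < l → ∀ x y : X, (x, y) ∈ G.graph → l * ‖x‖ ≤ ‖l • x - y‖
  range : ∀ l : ℝ, 0 < l → ∀ z : X, ∃ x y : X, (x, y) ∈ G.graph ∧ l • x - y = z

/-- An m-dissipative operator has resolvents, with the Hille-Yosida bound. -/
lemma IsMDissipative.exists_resolvent {G : X →ₗ.[ℝ] X} (hG : IsMDissipative G) {l : ℝ}
    (hl : 0 < l) :
    ∃ R : X →L[ℝ] X, (∀ z, (R z, l • R z - z) ∈ G.graph) ∧ ∀ z, l * ‖R z‖ ≤ ‖z‖ := by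
  choose r y hr hz using hG.range l hl
  have key : ∀ z, (r z, l • r z - z) ∈ G.graph := fun z => by
    have : l • r z - z = y z := by
      nth_rw 2 [← hz z]
      abel
    rw [this]
    exact hr z
  have bd : ∀ x z, (x, l • x - z) ∈ G.graph → l * ‖x‖ ≤ ‖z‖ := fun x z h => by
    simpa using hG.dissipative l hl _ _ h
  have uniq : ∀ x z, (x, l • x - z) ∈ G.graph → x = r z := fun x z h => by
    have h1 := G.graph.sub_mem h (key z)
    have h2 := bd (x - r z) 0 (by
      convert h1 using 1
      simp only [Prod.mk_sub_mk, Prod.mk.injEq, true_and, smul_sub]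
      abel)
    rw [norm_zero] at h2
    have : ‖x - r z‖ ≤ 0 := by
      by_contra! h3
      exact absurd h2 (not_le.2 (mul_pos hl h3))
    exact sub_eq_zero.1 (norm_le_zero_iff.1 this)
  -- Linearity of the chosen solution map is a consequence of uniqueness, since the graph is a
  -- subspace.
  let R₀ : X →ₗ[ℝ] X :=
    { toFun := r
      map_add' := fun u v => (uniq _ _ (by
        convert G.graph.add_mem (key u) (key v) using 1
        simp only [Prod.mk_add_mk, Prod.mk.injEq, true_and, smul_add]
        abel)).symm
      map_smul' := fun k u => (uniq _ _ (by
        convert G.graph.smul_mem k (key u) using 1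
        simp only [Prod.smul_mk, Prod.mk.injEq, smul_sub, RingHom.id_apply]
        rw [smul_comm]
        exact ⟨trivial, rfl⟩)).symm }
  refine ⟨R₀.mkContinuous l⁻¹ fun z => ?_, key, fun z => bd _ _ (key z)⟩
  rw [inv_mul_eq_div, le_div_iff₀' hl]
  exact bd _ _ (key z)

/-- A resolvent inverts `l - G` on the domain of `G`. -/
lemma IsMDissipative.resolvent_apply {G : X →ₗ.[ℝ] X} (hG : IsMDissipative G) {l : ℝ}
    (hl : 0 < l) {R : X →L[ℝ] X} (hR : ∀ z, (R z, l • R z - z) ∈ G.graph) {x y : X}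
    (hxy : (x, y) ∈ G.graph) : R (l • x - y) = x := by
  have h1 := hG.dissipative l hl _ _ (G.graph.sub_mem (hR (l • x - y)) hxy)
  have h2 : l • (R (l • x - y) - x) - (l • R (l • x - y) - (l • x - y) - y) = 0 := by
    rw [smul_sub]
    abel
  rw [h2, norm_zero] at h1
  have : ‖R (l • x - y) - x‖ ≤ 0 := by
    by_contra! h3
    exact absurd h1 (not_le.2 (mul_pos hl h3))
  exact sub_eq_zero.1 (norm_le_zero_iff.1 this)

/-- The resolvent identity in its two forms, `Q = R + (l - m) R Q` and `R = Q + (m - l) Q R`, gives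
`(l - m)(R Q - Q R) = 0`. If `l = m`, the first form already says `Q = R`. -/
lemma IsMDissipative.commute_resolvent {G : X →ₗ.[ℝ] X} (hG : IsMDissipative G) {l m : ℝ}
    (hl : 0 < l) (hm : 0 < m) {R Q : X →L[ℝ] X} (hR : ∀ z, (R z, l • R z - z) ∈ G.graph)
    (hQ : ∀ z, (Q z, m • Q z - z) ∈ G.graph) : Commute R Q := by
  have h1 : ∀ z, Q z = R z + (l - m) • R (Q z) := fun z => by
    have := hG.resolvent_apply hl hR (hQ z)
    rw [← map_smul, ← map_add]
    nth_rw 1 [← this]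
    congr 1
    rw [sub_smul]
    abel
  have h2 : ∀ z, R z = Q z + (m - l) • Q (R z) := fun z => by
    have := hG.resolvent_apply hm hQ (hR z)
    rw [← map_smul, ← map_add]
    nth_rw 1 [← this]
    congr 1
    rw [sub_smul]
    abel
  ext z
  change R (Q z) = Q (R z)
  rcases eq_or_ne l m with rfl | hne
  · have hRQ : ∀ z, Q z = R z := fun z => by simpa using h1 z
    rw [hRQ, hRQ]
  · have h3 : (l - m) • (R (Q z) - Q (R z)) = 0 := by
      have h4 := h2 z
      nth_rw 1 [h1 z] at h4
      have h5 : (m - l) • Q (R z) = -((l - m) • Q (R z)) := by rw [← neg_smul, neg_sub]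
      rw [h5] at h4
      rw [smul_sub, sub_eq_zero]
      have h6 : R z = (R z + (l - m) • R (Q z)) + -((l - m) • Q (R z)) := h4
      have h7 : (l - m) • R (Q z) + -((l - m) • Q (R z)) = 0 := by
        rw [add_assoc] at h6
        exact left_eq_add.1 h6
      rw [← sub_eq_add_neg] at h7
      exact sub_eq_zero.1 h7
    exact sub_eq_zero.1 ((smul_eq_zero.1 h3).resolve_left (sub_ne_zero.2 hne))

variable [CompleteSpace X]

lemma exp_add_of_commute {A B : X →L[ℝ] X} (h : Commute A B) :
    NormedSpace.exp (A + B) = NormedSpace.exp A * NormedSpace.exp B := by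
  let +nondep : NormedAlgebra ℚ (X →L[ℝ] X) := .restrictScalars ℚ ℝ _
  exact NormedSpace.exp_add_of_commute h

/-- `exp (m P - m)` is a contraction if `P` is one. -/
lemma norm_exp_smul_sub_one_le {P : X →L[ℝ] X} (hP : ‖P‖ ≤ 1) {m : ℝ} (hm : 0 ≤ m) :
    ‖NormedSpace.exp (m • (P - 1))‖ ≤ 1 := by
  -- The identity has norm one only on a nontrivial space.
  rcases subsingleton_or_nontrivial X with hX | hX
  · rw [Subsingleton.elim (NormedSpace.exp (m • (P - 1))) 0, norm_zero]
    exact zero_le_one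
  -- The exponential factors as `exp (m P)` times the scalar `e^{-m}`, and the series bounds the
  -- first factor by `e^m`.
  have e1 : m • (P - 1) = m • P + algebraMap ℝ (X →L[ℝ] X) (-m) := by
    rw [Algebra.algebraMap_eq_smul_one, smul_sub, neg_smul, sub_eq_add_neg]
  have hc : Commute (m • P) (algebraMap ℝ (X →L[ℝ] X) (-m)) := (Algebra.commutes _ _).symm
  have h1 : ‖NormedSpace.exp (m • P)‖ ≤ Real.exp m := by
    rw [NormedSpace.exp_eq_tsum ℝ]
    refine tsum_of_norm_bounded (g := fun n : ℕ => (n.factorial : ℝ)⁻¹ • m ^ n) ?_ fun n => ?_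
    · rw [Real.exp_eq_exp_ℝ]
      exact NormedSpace.exp_series_hasSum_exp' m
    · rw [norm_smul, smul_eq_mul, Real.norm_of_nonneg (by positivity)]
      refine mul_le_mul_of_nonneg_left ((norm_pow_le _ _).trans ?_) (by positivity)
      refine pow_le_pow_left₀ (norm_nonneg _) ?_ n
      rw [norm_smul, Real.norm_of_nonneg hm]
      exact mul_le_of_le_one_right hm hP
  rw [e1, exp_add_of_commute hc, ← NormedSpace.algebraMap_exp_comm]
  refine (norm_mul_le _ _).trans ?_
  rw [norm_algebraMap', ← Real.exp_eq_exp_ℝ, Real.norm_of_nonneg (Real.exp_pos _).le]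
  calc _ ≤ Real.exp m * Real.exp (-m) := by gcongr
    _ = 1 := by rw [← Real.exp_add, add_neg_cancel, Real.exp_zero]

lemma hasDerivAt_exp_smul_apply (A : X →L[ℝ] X) (x : X) (s : ℝ) :
    HasDerivAt (fun s : ℝ => NormedSpace.exp (s • A) x) (NormedSpace.exp (s • A) (A x)) s := by
  have h := hasDerivAt_exp_smul_const (𝕂 := ℝ) A s
  exact (ContinuousLinearMap.apply ℝ X x).hasFDerivAt.comp_hasDerivAt s h

/-- Semigroups of contractions with commuting bounded generators. -/
lemma norm_exp_smul_sub_le {A B : X →L[ℝ] X} (hAB : Commute A B)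
    (hA : ∀ s : ℝ, 0 ≤ s → ‖NormedSpace.exp (s • A)‖ ≤ 1)
    (hB : ∀ s : ℝ, 0 ≤ s → ‖NormedSpace.exp (s • B)‖ ≤ 1) {t : ℝ} (ht : 0 ≤ t) (x : X) :
    ‖NormedSpace.exp (t • A) x - NormedSpace.exp (t • B) x‖ ≤ t * ‖A x - B x‖ := by
  have hc : Commute (A - B) B := hAB.sub_left (Commute.refl B)
  -- The path `s ↦ exp (s (A - B)) exp (t B) x` joins `exp (t B) x` to `exp (t A) x`. By
  -- commutativity its derivative is `exp (s A) exp ((t - s) B) (A x - B x)`, a contraction applied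
  -- to a fixed vector.
  have key := norm_image_sub_le_of_norm_deriv_le_segment'
    (f := fun s : ℝ => NormedSpace.exp (s • (A - B)) (NormedSpace.exp (t • B) x))
    (a := 0) (b := t) (C := ‖A x - B x‖)
    (fun s _ => (hasDerivAt_exp_smul_apply _ _ s).hasDerivWithinAt) ?_ t ⟨ht, le_rfl⟩
  · have e : NormedSpace.exp (t • (A - B)) (NormedSpace.exp (t • B) x)
        = NormedSpace.exp (t • A) x := by
      change (NormedSpace.exp (t • (A - B)) * NormedSpace.exp (t • B)) x = _
      rw [← exp_add_of_commute ((hc.smul_left t).smul_right t), ← smul_add,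
        sub_add_cancel]
    simp only [e, zero_smul, NormedSpace.exp_zero, one_apply_eq_self, sub_zero] at key
    rwa [mul_comm]
  · intro s hs
    have e : NormedSpace.exp (s • (A - B)) ((A - B) (NormedSpace.exp (t • B) x))
        = (NormedSpace.exp (s • A) * NormedSpace.exp ((t - s) • B)) (A x - B x) := by
      have e1 : (A - B) * NormedSpace.exp (t • B) = NormedSpace.exp (t • B) * (A - B) := by
        let +nondep : NormedAlgebra ℚ (X →L[ℝ] X) := .restrictScalars ℚ ℝ _
        exact (hc.smul_right t).exp_right
      have e2 : NormedSpace.exp (s • (A - B)) * NormedSpace.exp (t • B)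
          = NormedSpace.exp (s • A) * NormedSpace.exp ((t - s) • B) := by
        rw [← exp_add_of_commute ((hc.smul_left s).smul_right t),
          ← exp_add_of_commute ((hAB.smul_left s).smul_right (t - s))]
        congr 1
        rw [smul_sub, sub_smul]
        abel
      rw [← e2]
      have e3 : (A - B) (NormedSpace.exp (t • B) x) = NormedSpace.exp (t • B) (A x - B x) :=
        DFunLike.congr_fun e1 x
      rw [e3]
      rfl
    rw [e]
    refine (ContinuousLinearMap.le_of_opNorm_le _ ?_ _).trans (one_mul _).le
    refine (norm_mul_le _ _).trans ?_
    exact mul_le_one₀ (hA s hs.1) (norm_nonneg _) (hB _ (by linarith [hs.2]))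

end HilleYosida

/-! ### Yosida approximation and the Hille-Yosida theorem. -/

section HilleYosida

variable {X : Type*} [NormedAddCommGroup X] [NormedSpace ℝ X]

/-- Uniformly bounded operators that converge pointwise to the identity on a dense set converge
to it everywhere. -/
lemma tendsto_apply_of_dense {P : ℕ → X →L[ℝ] X} (hP : ∀ n, ‖P n‖ ≤ 1) {D : Set X}
    (hD : Dense D) (h : ∀ x ∈ D, Tendsto (fun n => P n x) atTop (𝓝 x)) (x : X) :
    Tendsto (fun n => P n x) atTop (𝓝 x) := by
  rw [Metric.tendsto_atTop]
  intro ε hε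
  obtain ⟨z, hz, hxz⟩ := hD.exists_dist_lt x (ε := ε / 3) (by positivity)
  obtain ⟨N, hN⟩ := Metric.tendsto_atTop.1 (h z hz) (ε / 3) (by positivity)
  refine ⟨N, fun n hn => ?_⟩
  have h1 : dist (P n x) (P n z) ≤ dist x z := by
    rw [dist_eq_norm, dist_eq_norm, ← map_sub]
    exact ((P n).le_of_opNorm_le (hP n) _).trans (one_mul _).le
  have h2 := hN n hn
  have h3 := dist_triangle4 (P n x) (P n z) z x
  rw [dist_comm z x] at h3
  linarith

/-- Uniformly bounded operators whose orbits are Cauchy on a dense set have Cauchy orbits. -/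
lemma cauchySeq_apply_of_dense {P : ℕ → X →L[ℝ] X} (hP : ∀ n, ‖P n‖ ≤ 1) {D : Set X}
    (hD : Dense D) (h : ∀ x ∈ D, CauchySeq (fun n => P n x)) (x : X) :
    CauchySeq (fun n => P n x) := by
  rw [Metric.cauchySeq_iff]
  intro ε hε
  obtain ⟨z, hz, hxz⟩ := hD.exists_dist_lt x (ε := ε / 3) (by positivity)
  obtain ⟨N, hN⟩ := Metric.cauchySeq_iff.1 (h z hz) (ε / 3) (by positivity)
  refine ⟨N, fun n hn m hm => ?_⟩
  have h1 : ∀ n, dist (P n x) (P n z) ≤ dist x z := fun n => by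
    rw [dist_eq_norm, dist_eq_norm, ← map_sub]
    exact ((P n).le_of_opNorm_le (hP n) _).trans (one_mul _).le
  have h2 := hN n hn m hm
  have h3 := dist_triangle4 (P n x) (P n z) (P m z) (P m x)
  rw [dist_comm (P m z)] at h3
  linarith [h1 n, h1 m]

variable [CompleteSpace X]

lemma norm_exp_smul_sub_self_le {A : X →L[ℝ] X}
    (hA : ∀ s : ℝ, 0 ≤ s → ‖NormedSpace.exp (s • A)‖ ≤ 1) {t : ℝ} (ht : 0 ≤ t) (x : X) :
    ‖NormedSpace.exp (t • A) x - x‖ ≤ t * ‖A x‖ := by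
  have h := norm_exp_smul_sub_le (Commute.zero_right A) hA (fun s _ => by
    rw [smul_zero, NormedSpace.exp_zero]
    exact ContinuousLinearMap.norm_id_le) ht x
  simpa [NormedSpace.exp_zero] using h

/-- First order expansion of the semigroup `exp (t A)` at `x`, where `y` is close to `A x`. -/
lemma norm_exp_smul_sub_sub_le {A : X →L[ℝ] X}
    (hA : ∀ s : ℝ, 0 ≤ s → ‖NormedSpace.exp (s • A)‖ ≤ 1) {t : ℝ} (ht : 0 ≤ t) (x y z : X) :
    ‖NormedSpace.exp (t • A) x - x - t • y‖ ≤ (‖A x - y‖ + 2 * ‖y - z‖ + t * ‖A z‖) * t := by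
  have key := norm_image_sub_le_of_norm_deriv_le_segment'
    (f := fun s : ℝ => NormedSpace.exp (s • A) x - s • y)
    (a := 0) (b := t) (C := ‖A x - y‖ + 2 * ‖y - z‖ + t * ‖A z‖)
    (fun s _ => ((hasDerivAt_exp_smul_apply A x s).sub
      ((hasDerivAt_id s).smul_const y)).hasDerivWithinAt) ?_ t ⟨ht, le_rfl⟩
  · simp only [zero_smul, NormedSpace.exp_zero, one_apply_eq_self, sub_zero] at key
    convert key using 2
    abel
  · intro s hs
    set E := NormedSpace.exp (s • A)
    have hE : ∀ u, ‖E u‖ ≤ ‖u‖ := fun u =>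
      (E.le_of_opNorm_le (hA s hs.1) u).trans (one_mul _).le
    -- The term `E y - y` has no rate when `y` is outside the domain, so it is moved to a nearby
    -- `z`, where `E z - z` is at most `t ‖A z‖`. The detour costs `2 ‖y - z‖`.
    have e : E (A x) - (1 : ℝ) • y = E (A x - y) + E (y - z) + (E z - z) + (z - y) := by
      simp only [map_sub, one_smul]
      abel
    rw [e]
    have h1 := norm_exp_smul_sub_self_le hA hs.1 z
    have h2 : s * ‖A z‖ ≤ t * ‖A z‖ := mul_le_mul_of_nonneg_right hs.2.le (norm_nonneg _)
    have h3 := norm_add₃_le (a := E (A x - y)) (b := E (y - z)) (c := E z - z)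
    have h4 := norm_add_le (E (A x - y) + E (y - z) + (E z - z)) (z - y)
    rw [norm_sub_rev z y] at h4
    linarith [hE (A x - y), hE (y - z)]

/-- The Yosida approximations of an m-dissipative operator. -/
lemma IsMDissipative.exists_yosida {G : X →ₗ.[ℝ] X} (hG : IsMDissipative G) :
    ∃ A : ℕ → X →L[ℝ] X, (∀ n m, Commute (A n) (A m)) ∧
      (∀ n, ∀ s : ℝ, 0 ≤ s → ‖NormedSpace.exp (s • A n)‖ ≤ 1) ∧
      ∀ x y, (x, y) ∈ G.graph → Tendsto (fun n => A n x) atTop (𝓝 y) ∧ ∀ n, ‖A n x‖ ≤ ‖y‖ := by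
  have hl : ∀ n : ℕ, (0 : ℝ) < n + 1 := fun n => by positivity
  choose R hR hRb using fun n : ℕ => hG.exists_resolvent (hl n)
  -- These contractions tend strongly to the identity, because `P n x - x = R n y` has norm at most
  -- `‖y‖ / (n + 1)` on the domain. The approximation `(n + 1)(P n - 1)` equals `P n ∘ G` there,
  -- hence tends to `G`.
  set P : ℕ → X →L[ℝ] X := fun n => ((n : ℝ) + 1) • R n
  have hPb : ∀ n z, ‖P n z‖ ≤ ‖z‖ := fun n z => by
    change ‖((n : ℝ) + 1) • R n z‖ ≤ _
    rw [norm_smul, Real.norm_of_nonneg (hl n).le]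
    exact hRb n z
  have hP1 : ∀ n, ‖P n‖ ≤ 1 := fun n =>
    (P n).opNorm_le_bound zero_le_one fun z => by simpa using hPb n z
  have hPR : ∀ n x y, (x, y) ∈ G.graph → P n x - x = R n y := fun n x y h => by
    have h1 := hG.resolvent_apply (hl n) (hR n) h
    rw [map_sub, map_smul] at h1
    change ((n : ℝ) + 1) • R n x - x = R n y
    nth_rw 2 [← h1]
    abel
  have hPt : ∀ z, Tendsto (fun n => P n z) atTop (𝓝 z) := by
    refine tendsto_apply_of_dense hP1 hG.dense_domain fun x hx => ?_
    obtain ⟨y, hy⟩ : ∃ y, (x, y) ∈ G.graph := ⟨G ⟨x, hx⟩, G.mem_graph ⟨x, hx⟩⟩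
    rw [tendsto_iff_norm_sub_tendsto_zero]
    refine squeeze_zero (fun n => norm_nonneg _) (g := fun n : ℕ => ‖y‖ * (1 / ((n : ℝ) + 1)))
      (fun n => ?_) ?_
    · rw [hPR n x y hy, mul_one_div, le_div_iff₀' (hl n)]
      exact hRb n y
    · simpa using tendsto_one_div_add_atTop_nhds_zero_nat.const_mul ‖y‖
  have hAP : ∀ (n : ℕ) (x y : X), (x, y) ∈ G.graph → (((n : ℝ) + 1) • (P n - 1)) x = P n y :=
      fun n x y h => by
    change ((n : ℝ) + 1) • (P n x - x) = _
    rw [hPR n x y h]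
    rfl
  refine ⟨fun n => ((n : ℝ) + 1) • (P n - 1), fun n m => ?_, fun n s hs => ?_, fun x y h => ?_⟩
  · have h0 : Commute (P n) (P m) :=
      ((hG.commute_resolvent (hl n) (hl m) (hR n) (hR m)).smul_left _).smul_right _
    exact (((h0.sub_left (Commute.one_left _)).sub_right
      (Commute.one_right _)).smul_left _).smul_right _
  · rw [smul_smul]
    exact norm_exp_smul_sub_one_le (hP1 n) (mul_nonneg hs (hl n).le)
  · simp only [hAP _ x y h]
    exact ⟨hPt y, fun n => hPb n y⟩

/-- **Hille-Yosida theorem** for contraction semigroups. -/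
theorem IsMDissipative.exists_semigroup {G : X →ₗ.[ℝ] X} (hG : IsMDissipative G) :
    ∃ S : C0Semigroup X, IsGenerator G S ∧ ∀ t x, ‖S t x‖ ≤ ‖x‖ := by
  obtain ⟨A, hcomm, hcontr, hA⟩ := hG.exists_yosida
  have hgr : ∀ x ∈ G.domain, ∃ y, (x, y) ∈ G.graph := fun x hx => ⟨G ⟨x, hx⟩, G.mem_graph ⟨x, hx⟩⟩
  have hTb : ∀ n (t : ℝ≥0) x, ‖NormedSpace.exp ((t : ℝ) • A n) x‖ ≤ ‖x‖ := fun n t x =>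
    (ContinuousLinearMap.le_of_opNorm_le _ (hcontr n t t.2) x).trans (one_mul _).le
  have hlim : ∀ (t : ℝ≥0) (x : X), ∃ u,
      Tendsto (fun n => NormedSpace.exp ((t : ℝ) • A n) x) atTop (𝓝 u) := by
    intro t x
    refine cauchySeq_tendsto_of_complete (cauchySeq_apply_of_dense (fun n => hcontr n t t.2)
      hG.dense_domain (fun z hz => ?_) x)
    obtain ⟨y, hy⟩ := hgr z hz
    rw [Metric.cauchySeq_iff]
    intro ε hε
    -- Dividing by `t + 1` instead of `t` covers `t = 0`.
    have ht : (0 : ℝ) < t + 1 := by positivity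
    obtain ⟨N, hN⟩ := Metric.cauchySeq_iff.1 (hA z y hy).1.cauchySeq (ε / (t + 1)) (by positivity)
    refine ⟨N, fun n hn m hm => ?_⟩
    have h1 := hN n hn m hm
    rw [lt_div_iff₀' ht, dist_eq_norm] at h1
    rw [dist_eq_norm]
    have h2 := norm_exp_smul_sub_le (hcomm n m) (hcontr n) (hcontr m) t.2 z
    have h3 := norm_nonneg (A n z - A m z)
    calc _ ≤ _ := h2
      _ ≤ ((t : ℝ) + 1) * ‖A n z - A m z‖ := by gcongr; simp
      _ < ε := h1
  choose s hs using hlim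
  have hsb : ∀ t x, ‖s t x‖ ≤ ‖x‖ := fun t x =>
    le_of_tendsto (hs t x).norm (Eventually.of_forall fun n => hTb n t x)
  let S₀ : ℝ≥0 → X →L[ℝ] X := fun t =>
    LinearMap.mkContinuous
      { toFun := s t
        map_add' := fun u v => tendsto_nhds_unique (hs t (u + v)) (by
          simpa only [map_add] using (hs t u).add (hs t v))
        map_smul' := fun k u => tendsto_nhds_unique (hs t (k • u)) (by
          simpa only [map_smul, RingHom.id_apply] using (hs t u).const_smul k) } 1
      fun x => (hsb t x).trans (one_mul _).ge
  have hzero : S₀ 0 = ContinuousLinearMap.id ℝ X := by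
    ext x
    refine tendsto_nhds_unique (hs 0 x) ?_
    simp [NormedSpace.exp_zero]
  have hadd : ∀ t u, S₀ (t + u) = (S₀ t).comp (S₀ u) := by
    intro t u
    ext x
    refine tendsto_nhds_unique (hs (t + u) x) ?_
    -- The inner orbit is replaced by its limit; the outer exponentials are contractions, so the
    -- error tends to zero.
    have e : ∀ n, NormedSpace.exp (((t + u : ℝ≥0) : ℝ) • A n) x =
        NormedSpace.exp ((t : ℝ) • A n) (NormedSpace.exp ((u : ℝ) • A n) x - s u x) +
          NormedSpace.exp ((t : ℝ) • A n) (s u x) := fun n => by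
      rw [NNReal.coe_add, add_smul,
        exp_add_of_commute (((Commute.refl (A n)).smul_left _).smul_right _), ← map_add,
        sub_add_cancel]
      rfl
    simp only [e]
    have h0 : Tendsto (fun n => NormedSpace.exp ((u : ℝ) • A n) x - s u x) atTop (𝓝 0) := by
      simpa using (hs u x).sub_const (s u x)
    have h1 : Tendsto (fun n => NormedSpace.exp ((t : ℝ) • A n)
        (NormedSpace.exp ((u : ℝ) • A n) x - s u x)) atTop (𝓝 0) :=
      squeeze_zero_norm (fun n => hTb n t _) (by simpa using h0.norm)
    have h2 := h1.add (hs t (s u x))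
    rwa [zero_add] at h2
  have hlip : ∀ x y, (x, y) ∈ G.graph → ∀ t, ‖S₀ t x - x‖ ≤ t * ‖y‖ := fun x y h t => by
    refine le_of_tendsto ((hs t x).sub_const x).norm (Eventually.of_forall fun n => ?_)
    exact (norm_exp_smul_sub_self_le (hcontr n) t.2 x).trans
      (mul_le_mul_of_nonneg_left ((hA x y h).2 n) t.2)
  have hcontD : ∀ x ∈ G.domain, Continuous fun t => S₀ t x := by
    intro x hx
    obtain ⟨y, hy⟩ := hgr x hx
    refine (LipschitzWith.of_dist_le_mul (K := ‖y‖₊) fun t u => ?_).continuous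
    wlog htu : t ≤ u generalizing t u
    · rw [dist_comm, dist_comm t]
      exact this u t (le_of_not_ge htu)
    obtain ⟨r, rfl⟩ := exists_add_of_le htu
    rw [hadd, dist_comm, dist_comm t, dist_eq_norm, ContinuousLinearMap.comp_apply, ← map_sub,
      NNReal.dist_eq]
    refine (hsb t _).trans ((hlip x y hy r).trans (le_of_eq ?_))
    rw [NNReal.coe_add, add_sub_cancel_left, abs_of_nonneg r.coe_nonneg, coe_nnnorm, mul_comm]
  have hcont : ∀ x, Continuous fun t => S₀ t x := by
    intro x
    refine continuous_of_uniform_approx_of_continuous fun U hU => ?_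
    obtain ⟨ε, hε, hεU⟩ := Metric.mem_uniformity_dist.1 hU
    obtain ⟨z, hz, hxz⟩ := hG.dense_domain.exists_dist_lt x hε
    refine ⟨fun t => S₀ t z, hcontD z hz, fun t => hεU ?_⟩
    rw [dist_eq_norm, ← map_sub]
    rw [dist_eq_norm] at hxz
    exact (hsb t _).trans_lt hxz
  -- After division by `t`, the bound is made small by first taking `z` in the domain close to `y`
  -- and then `t` small.
  have hexp : ∀ x y, (x, y) ∈ G.graph → ∀ z w, (z, w) ∈ G.graph → ∀ t : ℝ≥0,
      ‖S₀ t x - x - (t : ℝ) • y‖ ≤ (2 * ‖y - z‖ + t * ‖w‖) * t := by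
    intro x y hxy z w hzw t
    refine le_of_tendsto_of_tendsto (((hs t x).sub_const x).sub_const ((t : ℝ) • y)).norm
      (b := atTop) (g := fun n => (‖A n x - y‖ + 2 * ‖y - z‖ + t * ‖w‖) * t) ?_
      (Eventually.of_forall fun n => ?_)
    · have h0 : Tendsto (fun n => ‖A n x - y‖) atTop (𝓝 0) := by
        simpa using ((hA x y hxy).1.sub_const y).norm
      simpa using ((h0.add_const (2 * ‖y - z‖)).add_const ((t : ℝ) * ‖w‖)).mul_const (t : ℝ)
    · refine (norm_exp_smul_sub_sub_le (hcontr n) t.2 x y z).trans ?_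
      have := (hA z w hzw).2 n
      have h0 : (0 : ℝ) ≤ t := t.2
      exact mul_le_mul_of_nonneg_right
        (by simpa using mul_le_mul_of_nonneg_left this h0) h0
  have hgen : ∀ x y, (x, y) ∈ G.graph →
      Tendsto (fun t : ℝ≥0 => (t : ℝ)⁻¹ • (S₀ t x - x)) (𝓝[>] 0) (𝓝 y) := by
    intro x y hxy
    rw [Metric.tendsto_nhds]
    intro ε hε
    obtain ⟨z, hz, hyz⟩ := hG.dense_domain.exists_dist_lt y (ε := ε / 4) (by positivity)
    obtain ⟨w, hw⟩ := hgr z hz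
    have h0 : Tendsto (fun t : ℝ≥0 => (t : ℝ) * ‖w‖) (𝓝[>] 0) (𝓝 0) := by
      have : Continuous fun t : ℝ≥0 => (t : ℝ) * ‖w‖ := by fun_prop
      simpa using (this.tendsto 0).mono_left nhdsWithin_le_nhds
    filter_upwards [h0.eventually_lt_const (show (0 : ℝ) < ε / 4 by positivity),
      self_mem_nhdsWithin] with t ht ht0
    have ht0' : (0 : ℝ) < t := ht0
    have e : (t : ℝ)⁻¹ • (S₀ t x - x) - y = (t : ℝ)⁻¹ • (S₀ t x - x - (t : ℝ) • y) := by
      rw [smul_sub _ _ ((t : ℝ) • y), smul_smul, inv_mul_cancel₀ ht0'.ne', one_smul]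
    rw [dist_eq_norm, e, norm_smul, norm_inv, Real.norm_of_nonneg ht0'.le, inv_mul_lt_iff₀ ht0']
    rw [dist_eq_norm] at hyz
    refine (hexp x y hxy z w hw t).trans_lt ?_
    rw [mul_comm]
    exact mul_lt_mul_of_pos_left (by linarith) ht0'
  refine ⟨⟨S₀, hzero, hadd, hcont⟩, fun x y => ⟨hgen x y, fun hxy => ?_⟩, hsb⟩
  -- The generator cannot exceed `G`: since `1 - G` is onto, `x - y = x' - y'` for some `(x', y')`
  -- in the graph. Then `v = x - x'` has difference quotients tending to `v` itself. If `v ≠ 0`,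
  -- this forces `‖S t v‖ > ‖v‖` for some small `t`, against contractivity.
  obtain ⟨x', y', hxy', he⟩ := hG.range 1 one_pos (x - y)
  rw [one_smul] at he
  have h1 := hxy.sub (hgen x' y' hxy')
  have h2 : Tendsto (fun t : ℝ≥0 => (t : ℝ)⁻¹ • (S₀ t (x - x') - (x - x'))) (𝓝[>] 0)
      (𝓝 (x - x')) := by
    have e : x - x' = y - y' := by
      rw [sub_eq_sub_iff_add_eq_add] at he ⊢
      rw [add_comm y, he]
    nth_rw 3 [e]
    refine h1.congr fun t => ?_
    rw [← smul_sub, map_sub]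
    congr 1
    change S₀ t x - x - _ = _
    abel
  set v := x - x'
  have hv : v = 0 := by
    by_contra hne
    have hpos : 0 < ‖v‖ := norm_pos_iff.2 hne
    obtain ⟨t, ht, ht0⟩ := ((Metric.tendsto_nhds.1 h2 ‖v‖ hpos).and self_mem_nhdsWithin).exists
    have ht0' : (0 : ℝ) < t := ht0
    have e : (t : ℝ)⁻¹ • (S₀ t v - v) - v = (t : ℝ)⁻¹ • (S₀ t v - (1 + (t : ℝ)) • v) := by
      rw [add_smul, one_smul, ← sub_sub, smul_sub _ _ ((t : ℝ) • v), smul_smul,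
        inv_mul_cancel₀ ht0'.ne', one_smul]
    rw [dist_eq_norm, e, norm_smul, norm_inv, Real.norm_of_nonneg ht0'.le,
      inv_mul_lt_iff₀ ht0'] at ht
    have h3 := norm_sub_norm_le ((1 + (t : ℝ)) • v) (S₀ t v)
    rw [norm_sub_rev, norm_smul, Real.norm_of_nonneg (by positivity)] at h3
    have h4 : ‖S₀ t v‖ ≤ ‖v‖ := hsb t v
    linarith
  have hx : x = x' := sub_eq_zero.1 hv
  have hy : y = y' := by
    rw [hx] at he
    exact (sub_right_injective he).symm
  rw [hx, hy]
  exact hxy'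

end HilleYosida

/-! ### Uniqueness of the semigroup with a given generator. -/

section Uniqueness

variable {X : Type*} [NormedAddCommGroup X] [NormedSpace ℝ X]

/-- The graph of a generator is invariant under the semigroup. -/
lemma IsGenerator.apply_mem_graph {G : X →ₗ.[ℝ] X} {S : C0Semigroup X} (hS : IsGenerator G S)
    {x y : X} (h : (x, y) ∈ G.graph) (s : ℝ≥0) : (S s x, S s y) ∈ G.graph := by
  rw [hS] at h ⊢
  refine (((S s).continuous.tendsto y).comp h).congr fun t => ?_
  have e : S t (S s x) = S s (S t x) := by
    change (S t).comp (S s) x = (S s).comp (S t) x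
    rw [← S.map_add', ← S.map_add', add_comm]
  simp only [Function.comp_apply, map_smul, map_sub, e]

/-- A densely defined operator that generates a bounded semigroup generates no other one. -/
theorem IsGenerator.unique {G : X →ₗ.[ℝ] X} {S T : C0Semigroup X} (hS : IsGenerator G S)
    (hT : IsGenerator G T) (hD : Dense (G.domain : Set X)) {M : ℝ}
    (hM : ∀ t x, ‖T t x‖ ≤ M * ‖x‖) (t : ℝ≥0) (x : X) : S t x = T t x := by
  suffices h : ∀ x ∈ G.domain, S t x = T t x from
    congrFun (Continuous.ext_on hD (S t).continuous (T t).continuous h) x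
  intro x hx
  obtain ⟨y, hy⟩ : ∃ y, (x, y) ∈ G.graph := ⟨G ⟨x, hx⟩, G.mem_graph ⟨x, hx⟩⟩
  -- This interpolates between `T t x` at `s = 0` and `S t x` at `s = t`. Generators control only
  -- quotients from the right, so it is shown to be continuous with vanishing right derivative.
  let u : ℝ → X := fun s => T (t - s).toNNReal (S s.toNNReal x)
  have hcont : Continuous u := by
    refine continuous_iff_continuousAt.2 fun s => ?_
    have h1 : Tendsto (fun r : ℝ => M * ‖S r.toNNReal x - S s.toNNReal x‖) (𝓝 s) (𝓝 0) := by
      have := ((((S.continuous' x).comp continuous_real_toNNReal).sub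
        (continuous_const (y := S s.toNNReal x))).norm.const_mul M).tendsto s
      simpa using this
    have h2 : Tendsto (fun r : ℝ => T (t - r).toNNReal (S r.toNNReal x - S s.toNNReal x))
        (𝓝 s) (𝓝 0) := squeeze_zero_norm (fun r => hM _ _) h1
    have h3 : Tendsto (fun r : ℝ => T (t - r).toNNReal (S s.toNNReal x)) (𝓝 s)
        (𝓝 (T (t - s).toNNReal (S s.toNNReal x))) :=
      ((T.continuous' (S s.toNNReal x)).comp
        (continuous_real_toNNReal.comp (continuous_const.sub continuous_id))).tendsto s
    have h4 := h2.add h3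
    rw [zero_add] at h4
    refine h4.congr fun r => ?_
    rw [← map_add, sub_add_cancel]
  have hder : ∀ s ∈ Ico (0 : ℝ) t, HasDerivWithinAt u 0 (Ici s) s := by
    intro s hs
    rw [hasDerivWithinAt_iff_tendsto_slope, Ici_sdiff_left]
    have hg := hS.apply_mem_graph hy s.toNNReal
    set v := S s.toNNReal x
    have h1 := (((hS _ _).1 hg).sub ((hT _ _).1 hg)).norm.const_mul M
    rw [sub_self, norm_zero, mul_zero] at h1
    have h2 : Tendsto (fun r : ℝ => (r - s).toNNReal) (𝓝[>] s) (𝓝[>] 0) := by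
      refine tendsto_nhdsWithin_of_tendsto_nhds_of_eventually_within _ ?_ ?_
      · have : Continuous fun r : ℝ => (r - s).toNNReal := by fun_prop
        simpa using (this.tendsto s).mono_left nhdsWithin_le_nhds
      · filter_upwards [self_mem_nhdsWithin] with r hr
        exact Real.toNNReal_pos.2 (sub_pos.2 hr)
    refine squeeze_zero_norm' ?_ (h1.comp h2)
    filter_upwards [self_mem_nhdsWithin, Ioo_mem_nhdsGT hs.2] with r hr hr2
    have hr0 : 0 < r - s := sub_pos.2 hr
    have e1 : S r.toNNReal x = S (r - s).toNNReal v := by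
      have : r.toNNReal = (r - s).toNNReal + s.toNNReal := by
        rw [← Real.toNNReal_add hr0.le hs.1, sub_add_cancel]
      rw [this, S.map_add']
      rfl
    have e2 : T ((t : ℝ) - s).toNNReal v = T ((t : ℝ) - r).toNNReal (T (r - s).toNNReal v) := by
      have : ((t : ℝ) - s).toNNReal = ((t : ℝ) - r).toNNReal + (r - s).toNNReal := by
        rw [← Real.toNNReal_add (sub_nonneg.2 hr2.2.le) hr0.le, sub_add_sub_cancel]
      rw [this, T.map_add']
      rfl
    -- Both difference quotients at `v` tend to the same generator value, and the bound on `T`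
    -- absorbs the varying outer operator.
    have e3 : slope u s r = T ((t : ℝ) - r).toNNReal
        ((((r - s).toNNReal : ℝ≥0) : ℝ)⁻¹ • (S (r - s).toNNReal v - v) -
          (((r - s).toNNReal : ℝ≥0) : ℝ)⁻¹ • (T (r - s).toNNReal v - v)) := by
      rw [slope_def_module, Real.coe_toNNReal _ hr0.le, ← smul_sub, map_smul, sub_sub_sub_cancel_right,
        map_sub, ← e2, ← e1]
    rw [e3]
    exact hM _ _
  have h := constant_of_has_deriv_right_zero hcont.continuousOn hder t ⟨t.2, le_rfl⟩
  have hT0 : ∀ z, T 0 z = z := fun z => by rw [T.map_zero']; rfl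
  have hS0 : ∀ z, S 0 z = z := fun z => by rw [S.map_zero']; rfl
  simpa [u, hT0, hS0] using h

end Uniqueness

/-! ### Functions with two derivatives on an interval. -/

section TwoDerivs

/-- On `[c, d]`, the function `F` has the derivative `p` and the continuous second derivative
`q`. -/
structure HasTwoDerivs (c d : ℝ) (F p q : ℝ → ℝ) : Prop where
  fst : ∀ x ∈ Icc c d, HasDerivWithinAt F (p x) (Icc c d) x
  snd : ∀ x ∈ Icc c d, HasDerivWithinAt p (q x) (Icc c d) x
  cont : ContinuousOn q (Icc c d)

namespace HasTwoDerivs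

variable {c d : ℝ} {F p q F' p' q' : ℝ → ℝ}

lemma D1_eq (hcd : c < d) (h : HasTwoDerivs c d F p q) {x : ℝ} (hx : x ∈ Icc c d) :
    D1 c d F x = p x :=
  (h.fst x hx).derivWithin (uniqueDiffOn_Icc hcd x hx)

lemma D2_eq (hcd : c < d) (h : HasTwoDerivs c d F p q) {x : ℝ} (hx : x ∈ Icc c d) :
    D2 c d F x = q x := by
  have hp : EqOn (iteratedDerivWithin 1 F (Icc c d)) p (Icc c d) := fun y hy => by
    rw [iteratedDerivWithin_one]
    exact h.D1_eq hcd hy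
  rw [D2, iteratedDerivWithin_succ, derivWithin_congr hp (hp hx)]
  exact (h.snd x hx).derivWithin (uniqueDiffOn_Icc hcd x hx)

lemma contDiffOn (hcd : c < d) (h : HasTwoDerivs c d F p q) : ContDiffOn ℝ 2 F (Icc c d) := by
  have hu := uniqueDiffOn_Icc hcd
  have h1 : ContDiffOn ℝ 1 p (Icc c d) := by
    rw [show (1 : WithTop ℕ∞) = 0 + 1 from (zero_add 1).symm,
      contDiffOn_succ_iff_derivWithin hu]
    refine ⟨fun x hx => (h.snd x hx).differentiableWithinAt, by simp, ?_⟩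
    rw [contDiffOn_zero]
    exact h.cont.congr fun x hx => (h.snd x hx).derivWithin (hu x hx)
  rw [show (2 : WithTop ℕ∞) = 1 + 1 from one_add_one_eq_two.symm,
    contDiffOn_succ_iff_derivWithin hu]
  exact ⟨fun x hx => (h.fst x hx).differentiableWithinAt, by simp,
    h1.congr fun x hx => (h.fst x hx).derivWithin (hu x hx)⟩

lemma of_contDiffOn (hcd : c < d) (h : ContDiffOn ℝ 2 F (Icc c d)) :
    HasTwoDerivs c d F (D1 c d F) (D2 c d F) := by
  have hu := uniqueDiffOn_Icc hcd
  have h' := h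
  rw [show (2 : WithTop ℕ∞) = 1 + 1 from one_add_one_eq_two.symm,
    contDiffOn_succ_iff_derivWithin hu] at h'
  refine ⟨fun x hx => (h'.1 x hx).hasDerivWithinAt, fun x hx => ?_, D2_cont hcd h⟩
  have h1 := (h'.2.2.differentiableOn (by norm_num) x hx).hasDerivWithinAt
  have h2 : D2 c d F x = derivWithin (derivWithin F (Icc c d)) (Icc c d) x := by
    rw [D2, iteratedDerivWithin_succ]
    exact derivWithin_congr (fun y _ => by rw [iteratedDerivWithin_one])
      (by rw [iteratedDerivWithin_one])
  rw [h2]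
  exact h1

lemma congr (h : HasTwoDerivs c d F p q) (hF : EqOn F' F (Icc c d)) (hq : EqOn q' q (Icc c d)) :
    HasTwoDerivs c d F' p q' :=
  ⟨fun x hx => (h.fst x hx).congr hF (hF hx), fun x hx => by rw [hq hx]; exact h.snd x hx,
    h.cont.congr hq⟩

lemma add (h : HasTwoDerivs c d F p q) (h' : HasTwoDerivs c d F' p' q') :
    HasTwoDerivs c d (fun x => F x + F' x) (fun x => p x + p' x) (fun x => q x + q' x) :=
  ⟨fun x hx => (h.fst x hx).add (h'.fst x hx), fun x hx => (h.snd x hx).add (h'.snd x hx),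
    h.cont.add h'.cont⟩

lemma const_mul (h : HasTwoDerivs c d F p q) (k : ℝ) :
    HasTwoDerivs c d (fun x => k * F x) (fun x => k * p x) (fun x => k * q x) :=
  ⟨fun x hx => (h.fst x hx).const_mul k, fun x hx => (h.snd x hx).const_mul k,
    continuousOn_const.mul h.cont⟩

lemma comp_neg (h : HasTwoDerivs c d F p q) :
    HasTwoDerivs (-d) (-c) (fun x => F (-x)) (fun x => -p (-x)) (fun x => q (-x)) := by
  have hm : MapsTo (fun x : ℝ => -x) (Icc (-d) (-c)) (Icc c d) := fun x hx =>
    ⟨by linarith [hx.2], by linarith [hx.1]⟩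
  have hn : ∀ x, HasDerivWithinAt (fun x : ℝ => -x) (-1) (Icc (-d) (-c)) x := fun x =>
    (hasDerivAt_neg x).hasDerivWithinAt
  refine ⟨fun x hx => ?_, fun x hx => ?_, h.cont.comp continuous_neg.continuousOn hm⟩
  · have := (h.fst (-x) (hm hx)).comp x (hn x) hm
    rwa [mul_neg_one] at this
  · have := ((h.snd (-x) (hm hx)).comp x (hn x) hm).neg
    rwa [mul_neg_one, neg_neg] at this

/-- At a maximum over `[x, d]` where the first derivative is nonnegative, the second derivative is
nonpositive. -/
lemma snd_nonpos (h : HasTwoDerivs c d F p q) {x : ℝ} (hx : x ∈ Ico c d) (hp : 0 ≤ p x)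
    (hmax : ∀ y ∈ Icc x d, F y ≤ F x) : q x ≤ 0 := by
  -- If `q x > 0`, then `p` increases strictly to the right of `x` from a nonnegative value, so `F`
  -- increases strictly there too. Only the right side is used, so `x = c` is allowed.
  by_contra! hq
  have hev : ∀ᶠ y in 𝓝[Icc c d] x, 0 < q y :=
    (h.cont x (Ico_subset_Icc_self hx)).eventually_const_lt hq
  have hev' : ∀ᶠ y in 𝓝[≥] x, 0 < q y := by
    rw [← nhdsWithin_Icc_eq_nhdsGE hx.2]
    exact hev.filter_mono (nhdsWithin_mono _ (Icc_subset_Icc_left hx.1))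
  obtain ⟨e, he, hpos⟩ := (mem_nhdsGE_iff_exists_Icc_subset).1 hev'
  set m := min e d
  have hxm : x < m := lt_min he hx.2
  have hsub : Icc x m ⊆ Icc c d := Icc_subset_Icc hx.1 (min_le_right _ _)
  have hpm : StrictMonoOn p (Icc x m) := by
    refine strictMonoOn_of_hasDerivWithinAt_pos (f' := q) (convex_Icc _ _)
      (fun y hy => ((h.snd y (hsub hy)).mono hsub).continuousWithinAt)
      (fun y hy => (h.snd y (hsub (interior_subset hy))).mono (interior_subset.trans hsub))
      fun y hy => ?_
    have := interior_subset hy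
    exact hpos ⟨this.1, this.2.trans (min_le_left _ _)⟩
  have hFm : StrictMonoOn F (Icc x m) := by
    refine strictMonoOn_of_hasDerivWithinAt_pos (f' := p) (convex_Icc _ _)
      (fun y hy => ((h.fst y (hsub hy)).mono hsub).continuousWithinAt)
      (fun y hy => (h.fst y (hsub (interior_subset hy))).mono (interior_subset.trans hsub))
      fun y hy => ?_
    rw [interior_Icc] at hy
    exact hp.trans_lt (hpm ⟨le_rfl, hxm.le⟩ ⟨hy.1.le, hy.2.le⟩ hy.1)
  exact absurd (hmax m ⟨hxm.le, min_le_right _ _⟩)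
    (not_le.2 (hFm ⟨le_rfl, hxm.le⟩ ⟨hxm.le, le_rfl⟩ hxm))

/-- The derivative vanishes at an interior maximum. -/
lemma fst_eq_zero (h : HasTwoDerivs c d F p q) {x : ℝ} (hx : x ∈ Ioo c d)
    (hmax : ∀ y ∈ Icc c d, F y ≤ F x) : p x = 0 := by
  have hn : Icc c d ∈ 𝓝 x := Icc_mem_nhds hx.1 hx.2
  have h1 : HasDerivAt F (p x) x := (h.fst x (Ioo_subset_Icc_self hx)).hasDerivAt hn
  exact IsLocalMax.hasDerivAt_eq_zero (by filter_upwards [hn] with y hy using hmax y hy) h1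

lemma of_polynomial (c d : ℝ) (P : Polynomial ℝ) :
    HasTwoDerivs c d (fun x => P.eval x) (fun x => P.derivative.eval x)
      (fun x => P.derivative.derivative.eval x) :=
  ⟨fun x _ => (P.hasDerivAt x).hasDerivWithinAt,
    fun x _ => (P.derivative.hasDerivAt x).hasDerivWithinAt,
    P.derivative.derivative.continuous.continuousOn⟩

end HasTwoDerivs

end TwoDerivs

/-! ### Passing between `C[a, b]` and functions on the line. -/

lemma lineExt_apply {a b : ℝ} (h : a ≤ b) (f : C(Icc a b, ℝ)) (x : Icc a b) :
    lineExt h f x = f x := IccExtend_val _ _ _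

lemma lineExt_of_mem {a b : ℝ} (h : a ≤ b) (f : C(Icc a b, ℝ)) {x : ℝ} (hx : x ∈ Icc a b) :
    lineExt h f x = f ⟨x, hx⟩ := IccExtend_of_mem _ _ hx

/-- The restriction to `[a, b]` of a function that is continuous there. -/
def restrictIcc {a b : ℝ} (F : ℝ → ℝ) (hF : ContinuousOn F (Icc a b)) : C(Icc a b, ℝ) :=
  ⟨fun x => F x, hF.domRestrict⟩

lemma lineExt_restrictIcc {a b : ℝ} (h : a ≤ b) {F : ℝ → ℝ} (hF : ContinuousOn F (Icc a b)) :
    EqOn (lineExt h (restrictIcc F hF)) F (Icc a b) := fun x hx => by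
  rw [lineExt_of_mem h _ hx]
  rfl

/-! ### The graphs of `G₁` and `G₂` -/

/-- The equation `f'' = 2 g` turns conditions on `f''` into conditions on `g`. The one at `0`
disappears, because `g` already vanishes there as an element of the space. -/
lemma mem_graph_opG1 {b : ℝ} {hb : 0 < b} {f g : C0Ioc b hb} :
    (f, g) ∈ (opG1 b hb).graph ↔
      ∃ p, HasTwoDerivs 0 b (lineExt hb.le f.1) p (fun x => 2 * lineExt hb.le g.1 x) ∧
        lineExt hb.le g.1 b = 0 := by
  rw [LinearPMap.mem_graph_iff]
  constructor
  · rintro ⟨y, rfl, rfl⟩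
    have e : ∀ x ∈ Icc 0 b, lineExt hb.le (opG1 b hb y).1 x
        = (1 / 2) * D2 0 b (lineExt hb.le y.1.1) x := fun x hx => lineExt_of_mem _ _ hx
    refine ⟨_, (HasTwoDerivs.of_contDiffOn hb y.2.1).congr (fun _ _ => rfl) fun x hx => ?_, ?_⟩
    · simp only [e x hx]
      ring
    · rw [e b (right_mem_Icc.2 hb.le), y.2.2.2, mul_zero]
  · rintro ⟨p, h, hgb⟩
    refine ⟨⟨f, h.contDiffOn hb, ?_, ?_⟩, rfl, ?_⟩
    · have h0 : g.1 ⟨0, le_rfl, hb.le⟩ = 0 := g.2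
      rw [h.D2_eq hb (left_mem_Icc.2 hb.le), lineExt_of_mem _ _ (left_mem_Icc.2 hb.le), h0, mul_zero]
    · rw [h.D2_eq hb (right_mem_Icc.2 hb.le), hgb, mul_zero]
    · ext x
      change (1 / 2) * D2 0 b (lineExt hb.le f.1) x = g.1 x
      rw [h.D2_eq hb x.2, lineExt_apply]
      ring

lemma mem_graph_opG2 {b γ : ℝ} {hb : 0 < b} {f g : C(Icc 0 b, ℝ)} :
    (f, g) ∈ (opG2 b γ hb).graph ↔
      ∃ p, HasTwoDerivs 0 b (lineExt hb.le f) p (fun x => 2 * lineExt hb.le g x) ∧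
        p 0 = γ * lineExt hb.le f 0 ∧ lineExt hb.le g b = 0 := by
  have h0 := left_mem_Icc.2 hb.le
  rw [LinearPMap.mem_graph_iff]
  constructor
  · rintro ⟨y, rfl, rfl⟩
    have e : ∀ x ∈ Icc 0 b, lineExt hb.le (opG2 b γ hb y) x
        = (1 / 2) * D2 0 b (lineExt hb.le y.1) x := fun x hx => lineExt_of_mem _ _ hx
    refine ⟨_, (HasTwoDerivs.of_contDiffOn hb y.2.1).congr (fun _ _ => rfl) fun x hx => ?_, ?_, ?_⟩
    · simp only [e x hx]
      ring
    · rw [lineExt_of_mem _ _ h0]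
      exact y.2.2.1
    · rw [e b (right_mem_Icc.2 hb.le), y.2.2.2, mul_zero]
  · rintro ⟨p, h, hp, hgb⟩
    refine ⟨⟨f, h.contDiffOn hb, ?_, ?_⟩, rfl, ?_⟩
    · rw [h.D1_eq hb h0, hp, lineExt_of_mem _ _ h0]
    · rw [h.D2_eq hb (right_mem_Icc.2 hb.le), hgb, mul_zero]
    · ext x
      change (1 / 2) * D2 0 b (lineExt hb.le f) x = g x
      rw [h.D2_eq hb x.2, lineExt_apply]
      ring

/-! ### Dissipativity -/

/-- The positive maximum principle for `½ f''` on `[0, b]`. -/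
lemma nonpos_of_isMax {b : ℝ} (hb : 0 < b) {f g : C(Icc 0 b, ℝ)} {p : ℝ → ℝ}
    (h : HasTwoDerivs 0 b (lineExt hb.le f) p (fun x => 2 * lineExt hb.le g x))
    (h0 : 0 ≤ lineExt hb.le f 0 * p 0) (hgb : lineExt hb.le g b = 0) {x : Icc 0 b}
    (hx : 0 < f x) (hmax : ∀ y, f y ≤ f x) : g x ≤ 0 := by
  have hmax' : ∀ y ∈ Icc 0 b, lineExt hb.le f y ≤ lineExt hb.le f x := fun y hy => by
    rw [lineExt_of_mem _ _ hy, lineExt_apply]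
    exact hmax _
  rw [← lineExt_apply hb.le] at hx ⊢
  -- At `b` the boundary condition gives `g = 0`. Elsewhere the second derivative test applies: the
  -- slope is zero at an interior maximum, and at `0` it is nonnegative by `h0` and `f 0 > 0`.
  rcases x.2.2.eq_or_lt with hxb | hxb
  · rw [hxb, hgb]
  have hp : 0 ≤ p x := by
    rcases x.2.1.eq_or_lt with hx0 | hx0
    · rw [← hx0] at hx ⊢
      exact nonneg_of_mul_nonneg_right h0 hx
    · exact (h.fst_eq_zero ⟨hx0, hxb⟩ hmax').ge
  have := h.snd_nonpos ⟨x.2.1, hxb⟩ hp fun y hy => hmax' y ⟨x.2.1.trans hy.1, hy.2⟩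
  linarith

/-- Where `|f|` is maximal and `f > 0`, the maximum principle gives `g ≤ 0`, so `l f - g ≥ l f` at
that point; if `f < 0`, pass to `-f`. The hypothesis `h0` covers both `f(0) = 0` and `f'(0) = γ
f(0)` with `γ ≥ 0`. -/
lemma mul_norm_le_norm_smul_sub {b : ℝ} (hb : 0 < b) {f g : C(Icc 0 b, ℝ)} {p : ℝ → ℝ}
    (h : HasTwoDerivs 0 b (lineExt hb.le f) p (fun x => 2 * lineExt hb.le g x))
    (h0 : 0 ≤ lineExt hb.le f 0 * p 0) (hgb : lineExt hb.le g b = 0) {l : ℝ} (hl : 0 < l) :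
    l * ‖f‖ ≤ ‖l • f - g‖ := by
  have hne : Nonempty (Icc 0 b) := ⟨⟨0, le_rfl, hb.le⟩⟩
  obtain ⟨x, -, hx⟩ := isCompact_univ.exists_isMaxOn univ_nonempty
    (f := fun x : Icc 0 b => ‖f x‖) (by fun_prop)
  have hmax : ∀ y, ‖f y‖ ≤ ‖f x‖ := fun y => hx (mem_univ y)
  have hfx : ‖f‖ ≤ ‖f x‖ := (f.norm_le (norm_nonneg _)).2 hmax
  have hle := (l • f - g).norm_coe_le_norm x
  have habs : ∀ y, |f y| ≤ |f x| := hmax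
  rcases lt_trichotomy (f x) 0 with hneg | hzero | hpos
  · have h' : HasTwoDerivs 0 b (lineExt hb.le (-f)) (fun x => -1 * p x)
        (fun x => 2 * lineExt hb.le (-g) x) :=
      (h.const_mul (-1)).congr (fun x hx => by simp [lineExt_of_mem _ _ hx])
        (fun x hx => by simp [lineExt_of_mem _ _ hx])
    have key := nonpos_of_isMax hb (x := x) h' (by
      have e : lineExt hb.le (-f) 0 = -lineExt hb.le f 0 := rfl
      rw [e]
      linarith) (by
      have e : lineExt hb.le (-g) b = -lineExt hb.le g b := rfl
      rw [e, hgb, neg_zero]) (by simpa using hneg) (fun y => by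
      have := habs y
      rw [abs_of_neg hneg] at this
      exact (neg_le_abs _).trans this)
    rw [ContinuousMap.neg_apply] at key
    refine le_trans ?_ hle
    refine (mul_le_mul_of_nonneg_left hfx hl.le).trans ?_
    rw [Real.norm_eq_abs, abs_of_neg hneg, Real.norm_eq_abs]
    refine le_trans ?_ (neg_le_abs _)
    simp only [ContinuousMap.sub_apply, ContinuousMap.smul_apply, smul_eq_mul]
    linarith
  · rw [hzero, norm_zero] at hfx
    rw [le_antisymm hfx (norm_nonneg _), mul_zero]
    exact norm_nonneg _
  · have key := nonpos_of_isMax hb (x := x) h h0 hgb hpos (fun y => by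
      have := habs y
      rw [abs_of_pos hpos] at this
      exact (le_abs_self _).trans this)
    refine le_trans ?_ hle
    refine (mul_le_mul_of_nonneg_left hfx hl.le).trans ?_
    rw [Real.norm_eq_abs, abs_of_pos hpos, Real.norm_eq_abs]
    refine le_trans ?_ (le_abs_self _)
    simp only [ContinuousMap.sub_apply, ContinuousMap.smul_apply, smul_eq_mul]
    linarith

/-! ### The resolvent equation -/

/-- The solutions of `F'' = ω² F - 2 g`, by variation of constants. -/
lemma exists_hasTwoDerivs_ode (b : ℝ) {ω : ℝ} (hω : 0 < ω) {g : ℝ → ℝ} (hg : Continuous g) :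
    ∃ V : ℝ, ∀ α β : ℝ, ∃ F p : ℝ → ℝ, F 0 = α ∧ p 0 = β ∧
      F b = V + α * Real.cosh (ω * b) + β * (Real.sinh (ω * b) / ω) ∧
      HasTwoDerivs 0 b F p (fun x => ω ^ 2 * F x - 2 * g x) := by
  set I : ℝ → ℝ := fun x => ∫ s in (0 : ℝ)..x, Real.exp (-(ω * s)) * g s
  -- With `I` and `K`, the particular solution `-(2/ω) ∫ sinh (ω (x - s)) g(s) ds` splits into
  -- products. It vanishes at `0` with its derivative, so `cosh` and `sinh / ω` carry the initial
  -- data; `V` is its value at `b`.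
  set K : ℝ → ℝ := fun x => ∫ s in (0 : ℝ)..x, Real.exp (ω * s) * g s
  have hId : ∀ x, HasDerivAt I (Real.exp (-(ω * x)) * g x) x := fun x =>
    ((by fun_prop : Continuous fun s => Real.exp (-(ω * s)) * g s).integral_hasStrictDerivAt
      0 x).hasDerivAt
  have hKd : ∀ x, HasDerivAt K (Real.exp (ω * x) * g x) x := fun x =>
    ((by fun_prop : Continuous fun s => Real.exp (ω * s) * g s).integral_hasStrictDerivAt
      0 x).hasDerivAt
  have hI0 : I 0 = 0 := intervalIntegral.integral_same
  have hK0 : K 0 = 0 := intervalIntegral.integral_same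
  have hee : ∀ x, Real.exp (ω * x) * Real.exp (-(ω * x)) = 1 := fun x => by
    rw [← Real.exp_add, add_neg_cancel, Real.exp_zero]
  have hlin : ∀ x, HasDerivAt (fun x => ω * x) ω x := fun x => by
    simpa using (hasDerivAt_id x).const_mul ω
  have hE : ∀ x, HasDerivAt (fun x => Real.exp (ω * x)) (Real.exp (ω * x) * ω) x := fun x =>
    (hlin x).exp
  have hE' : ∀ x, HasDerivAt (fun x => Real.exp (-(ω * x))) (Real.exp (-(ω * x)) * -ω) x :=
    fun x => (hlin x).neg.exp
  refine ⟨-(1 / ω) * (Real.exp (ω * b) * I b - Real.exp (-(ω * b)) * K b), fun α β => ?_⟩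
  set F : ℝ → ℝ := fun x => -(1 / ω) * (Real.exp (ω * x) * I x - Real.exp (-(ω * x)) * K x) +
    α * Real.cosh (ω * x) + β * (Real.sinh (ω * x) / ω) with hF
  set p : ℝ → ℝ := fun x => -(Real.exp (ω * x) * I x + Real.exp (-(ω * x)) * K x) +
    α * (Real.sinh (ω * x) * ω) + β * Real.cosh (ω * x) with hp
  have hFd : ∀ x, HasDerivAt F (p x) x := fun x => by
    have h := ((((hE x).mul (hId x)).sub ((hE' x).mul (hKd x))).const_mul (-(1 / ω))).add
      ((hlin x).cosh.const_mul α) |>.add (((hlin x).sinh.div_const ω).const_mul β)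
    refine h.congr_deriv ?_
    rw [hp]
    field_simp
    ring_nf
  have hpd : ∀ x, HasDerivAt p (ω ^ 2 * F x - 2 * g x) x := fun x => by
    have h := ((((hE x).mul (hId x)).add ((hE' x).mul (hKd x))).neg).add
      (((hlin x).sinh.mul_const ω).const_mul α) |>.add ((hlin x).cosh.const_mul β)
    refine h.congr_deriv ?_
    simp only [hF]
    field_simp
    linear_combination (-2 * g x) * hee x
  refine ⟨F, p, by simp [hF, hI0, hK0], by simp [hp, hI0, hK0], rfl,
    fun x _ => (hFd x).hasDerivWithinAt, fun x _ => (hpd x).hasDerivWithinAt, ?_⟩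
  have : Continuous F := continuous_iff_continuousAt.2 fun x => (hFd x).continuousAt
  fun_prop

/-- The solutions of `l F - ½ F'' = g` on `[0, b]` with `F''(b) = 0`, under a boundary condition
at `0`. -/
lemma exists_resolvent_solution {b : ℝ} (hb : 0 < b) {l : ℝ} (hl : 0 < l) (g : C(Icc 0 b, ℝ))
    {m n : ℝ} (hm : 0 ≤ m) (hn : 0 ≤ n) (hmn : 0 < m + n) :
    ∃ (f : C(Icc 0 b, ℝ)) (p : ℝ → ℝ) (k : ℝ),
      HasTwoDerivs 0 b (lineExt hb.le f) p (fun x => 2 * lineExt hb.le (l • f - g) x) ∧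
      lineExt hb.le f 0 = k * m ∧ p 0 = k * n ∧ lineExt hb.le (l • f - g) b = 0 := by
  -- The equation reads `F'' = 2 l F - 2 g`.
  set ω := √(2 * l)
  have hω : 0 < ω := Real.sqrt_pos.2 (by positivity)
  have hω2 : ω ^ 2 = 2 * l := Real.sq_sqrt (by positivity)
  obtain ⟨V, hV⟩ := exists_hasTwoDerivs_ode b hω (g := lineExt hb.le g) g.continuous.Icc_extend'
  set d := m * Real.cosh (ω * b) + n * (Real.sinh (ω * b) / ω)
  have hs : 0 < Real.sinh (ω * b) / ω := div_pos (Real.sinh_pos_iff.2 (by positivity)) hω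
  have hd : 0 < d := by
    rcases hm.eq_or_lt with rfl | hm'
    · have := mul_pos (show 0 < n by linarith) hs
      simpa [d] using this
    · have h1 := mul_pos hm' (Real.cosh_pos (ω * b))
      have h2 := mul_nonneg hn hs.le
      exact add_pos_of_pos_of_nonneg h1 h2
  -- Shooting from `0` with data `k (m, n)` gives `F b = V + k d`, and `F''(b) = 0` means `F b =
  -- g(b) / l`. The sign conditions on `m, n` make `d` positive.
  set k := (lineExt hb.le g b / l - V) / d
  obtain ⟨F, p, hF0, hp0, hFb, hF⟩ := hV (k * m) (k * n)
  have hc : ContinuousOn F (Icc 0 b) := fun x hx => (hF.fst x hx).continuousWithinAt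
  have e := lineExt_restrictIcc hb.le hc
  have e' : ∀ x ∈ Icc 0 b, lineExt hb.le (l • restrictIcc F hc - g) x
      = l * F x - lineExt hb.le g x := fun x hx => by
    rw [← e hx]
    rfl
  refine ⟨restrictIcc F hc, p, k, hF.congr e fun x hx => ?_, ?_, hp0, ?_⟩
  · simp only [e' x hx, hω2]
    ring
  · rw [e (left_mem_Icc.2 hb.le), hF0]
  · have h1 : F b = V + k * d := by
      rw [hFb]
      ring
    rw [e' b (right_mem_Icc.2 hb.le), h1, div_mul_cancel₀ _ hd.ne']
    field_simp
    ring


/-! ### Density of the domains -/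

/-- A small polynomial on `[0, b]` with `χ'(0) = 1`, vanishing to third order at `b`. -/
lemma exists_small_polynomial {b : ℝ} (hb : 0 < b) {ε : ℝ} (hε : 0 < ε) :
    ∃ P : Polynomial ℝ, P.eval 0 = 0 ∧ P.derivative.eval 0 = 1 ∧ P.eval b = 0 ∧
      P.derivative.eval b = 0 ∧ P.derivative.derivative.eval b = 0 ∧
      ∀ x ∈ Icc 0 b, |P.eval x| ≤ ε := by
  obtain ⟨n, hn⟩ := exists_nat_gt (b / ε)
  have hb' := hb.ne'
  -- The exponent is at least `3` for the vanishing at `b`. For smallness, put `y = x / b` and `N =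
  -- n + 3`: Bernoulli gives `(1 - y)^N (1 + N y) ≤ (1 - y²)^N ≤ 1`, so `n y (1 - y)^N ≤ 1`, and `n
  -- > b / ε`.
  refine ⟨.X * (1 - .C b⁻¹ * .X) ^ (n + 3), by simp, by simp, by simp [hb'], ?_, ?_, ?_⟩
  · simp [hb', Polynomial.derivative_pow]
  · simp [hb', Polynomial.derivative_pow]
  · intro x hx
    have hy0 : 0 ≤ b⁻¹ * x := mul_nonneg (inv_nonneg.2 hb.le) hx.1
    have hy1 : b⁻¹ * x ≤ 1 := by
      rw [inv_mul_le_iff₀ hb, mul_one]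
      exact hx.2
    have hx' : x = b * (b⁻¹ * x) := by field_simp
    simp only [Polynomial.eval_mul, Polynomial.eval_pow, Polynomial.eval_sub, Polynomial.eval_one,
      Polynomial.eval_C, Polynomial.eval_X]
    nth_rw 1 [hx']
    generalize b⁻¹ * x = y at hy0 hy1
    have hz : 0 ≤ (1 - y) ^ (n + 3) := pow_nonneg (by linarith) _
    rw [abs_of_nonneg (by positivity)]
    have h1 := one_add_mul_le_pow (show (-2 : ℝ) ≤ y by linarith) (n + 3)
    have h2 : (1 - y) ^ (n + 3) * (1 + y) ^ (n + 3) ≤ 1 := by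
      rw [← mul_pow]
      exact pow_le_one₀ (mul_nonneg (by linarith) (by linarith)) (by nlinarith)
    have h3 : (1 - y) ^ (n + 3) * (1 + ((n + 3 : ℕ) : ℝ) * y) ≤ 1 :=
      (mul_le_mul_of_nonneg_left h1 hz).trans h2
    push_cast at h3
    have h4 : (n : ℝ) * (y * (1 - y) ^ (n + 3)) ≤ 1 := by
      nlinarith [mul_nonneg hz hy0]
    rw [div_lt_iff₀ hε] at hn
    have h5 : 0 ≤ y * (1 - y) ^ (n + 3) := mul_nonneg hy0 hz
    have h6 := mul_le_mul_of_nonneg_right hn.le h5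
    have h7 := mul_le_mul_of_nonneg_left h4 hε.le
    linarith

/-- A small polynomial on `[0, b]` with `χ''(0) = 1`, vanishing to third order at `b`. -/
lemma exists_small_polynomial_snd {b : ℝ} (hb : 0 < b) {ε : ℝ} (hε : 0 < ε) :
    ∃ P : Polynomial ℝ, P.eval 0 = 0 ∧ P.derivative.eval 0 = 0 ∧ P.derivative.derivative.eval 0 = 1 ∧
      P.eval b = 0 ∧ P.derivative.eval b = 0 ∧ P.derivative.derivative.eval b = 0 ∧
      ∀ x ∈ Icc 0 b, |P.eval x| ≤ ε := by
  obtain ⟨P, h1, h2, h3, h4, h5, h6⟩ := exists_small_polynomial hb (div_pos hε hb)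
  -- The second derivative of `½ x P` at `0` is `P'(0) = 1`; the tolerance `ε / b` pays for the
  -- factor `x ≤ b`.
  refine ⟨.C (1 / 2) * .X * P, by simp, by simp [h1], ?_, by simp [h3], by simp [h3, h4], ?_, ?_⟩
  · simp [h2]
    norm_num
  · simp [h4, h5]
  · intro x hx
    have h7 := h6 x hx
    rw [le_div_iff₀ hb] at h7
    simp only [Polynomial.eval_mul, Polynomial.eval_C, Polynomial.eval_X]
    rw [abs_mul, abs_of_nonneg (by linarith [hx.1] : 0 ≤ 1 / 2 * x)]
    nlinarith [mul_le_mul_of_nonneg_right hx.2 (abs_nonneg (P.eval x)),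
      mul_nonneg hx.1 (abs_nonneg (P.eval x))]

/-- The mirror image of `exists_small_polynomial_snd`. -/
lemma exists_small_polynomial_snd' {b : ℝ} (hb : 0 < b) {ε : ℝ} (hε : 0 < ε) :
    ∃ P : Polynomial ℝ, P.eval 0 = 0 ∧ P.derivative.eval 0 = 0 ∧ P.derivative.derivative.eval 0 = 0 ∧
      P.derivative.derivative.eval b = 1 ∧ ∀ x ∈ Icc 0 b, |P.eval x| ≤ ε := by
  obtain ⟨P, h1, h2, h3, h4, h5, h6, h7⟩ := exists_small_polynomial_snd hb hε
  refine ⟨P.comp (.C b - .X), ?_, ?_, ?_, ?_, fun x hx => ?_⟩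
  · simp [h4]
  · simp [Polynomial.derivative_comp, h5]
  · simp [Polynomial.derivative_comp, h6]
  · simp [Polynomial.derivative_comp, h3]
  · simpa using h7 (b - x) ⟨by linarith [hx.2], by linarith [hx.1]⟩

/-- The restriction of a polynomial to `[a, b]`. -/
def polyIcc (a b : ℝ) (P : Polynomial ℝ) : C(Icc a b, ℝ) :=
  restrictIcc (fun x => P.eval x) P.continuous.continuousOn

lemma HasTwoDerivs.polyIcc {b : ℝ} (hb : 0 < b) (P : Polynomial ℝ) :
    HasTwoDerivs 0 b (lineExt hb.le (polyIcc 0 b P)) (fun x => P.derivative.eval x) (fun x =>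
      2 * lineExt hb.le (ElasticBM.polyIcc 0 b (.C (1 / 2) * P.derivative.derivative)) x) := by
  refine (HasTwoDerivs.of_polynomial 0 b P).congr (lineExt_restrictIcc _ _) fun x hx => ?_
  have := lineExt_restrictIcc hb.le
    (Polynomial.C (1 / 2) * P.derivative.derivative).continuous.continuousOn hx
  change 2 * lineExt hb.le (restrictIcc _ _) x = _
  rw [this]
  simp

lemma polyIcc_mem_domG2 {b γ : ℝ} {hb : 0 < b} {P : Polynomial ℝ}
    (h0 : P.derivative.eval 0 = γ * P.eval 0) (h1 : P.derivative.derivative.eval b = 0) :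
    polyIcc 0 b P ∈ domG2 b γ hb := by
  refine LinearPMap.mem_domain_of_mem_graph (f := opG2 b γ hb)
    (mem_graph_opG2.2 ⟨_, .polyIcc hb P, ?_, ?_⟩)
  · rw [lineExt_of_mem _ _ (left_mem_Icc.2 hb.le), h0]
    rfl
  · rw [lineExt_of_mem _ _ (right_mem_Icc.2 hb.le)]
    change Polynomial.eval b _ = 0
    simp [h1]

lemma polyIcc_mem_domG1 {b : ℝ} {hb : 0 < b} {P : Polynomial ℝ} (h0 : P.eval 0 = 0)
    (h1 : P.derivative.derivative.eval 0 = 0) (h2 : P.derivative.derivative.eval b = 0) :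
    (⟨polyIcc 0 b P, h0⟩ : C0Ioc b hb) ∈ domG1 b hb := by
  have h3 : polyIcc 0 b (.C (1 / 2) * P.derivative.derivative) ∈ C0Ioc b hb := by
    change Polynomial.eval 0 _ = 0
    simp [h1]
  have h4 : ((⟨polyIcc 0 b P, h0⟩, ⟨_, h3⟩) : C0Ioc b hb × C0Ioc b hb) ∈ (opG1 b hb).graph := by
    refine mem_graph_opG1.2 ⟨_, .polyIcc hb P, ?_⟩
    rw [lineExt_of_mem _ _ (right_mem_Icc.2 hb.le)]
    change Polynomial.eval b _ = 0
    simp [h2]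
  exact LinearPMap.mem_domain_of_mem_graph h4

lemma exists_polynomial_near {b : ℝ} (hb : 0 < b) (f : C(Icc 0 b, ℝ)) {ε : ℝ} (hε : 0 < ε) :
    ∃ P : Polynomial ℝ, ∀ x : Icc 0 b, |P.eval x.1 - f x| < ε := by
  obtain ⟨P, hP⟩ := exists_polynomial_near_of_continuousOn 0 b (lineExt hb.le f)
    f.continuous.Icc_extend'.continuousOn ε hε
  refine ⟨P, fun x => ?_⟩
  rw [← lineExt_apply hb.le]
  exact hP x x.2

lemma abs_mul_le_of_le_div {k y ε : ℝ} (h : |y| ≤ ε / (|k| + 1)) : |k * y| ≤ ε := by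
  have hk := abs_nonneg k
  rw [le_div_iff₀ (by positivity)] at h
  rw [abs_mul]
  nlinarith [abs_nonneg y]

/-- Each boundary condition is repaired by its own corrector: `A` changes only the slope condition
at `0`, `B` only the second derivative at `b`. The defects `k` and `m` are fixed by the
approximating polynomial first, and the correctors are then taken small relative to them. -/
lemma dense_domG2 (b γ : ℝ) (hb : 0 < b) : Dense (domG2 b γ hb : Set C(Icc 0 b, ℝ)) := by
  intro f
  rw [Metric.mem_closure_iff]
  intro ε hε
  have hne : Nonempty (Icc 0 b) := ⟨⟨0, le_rfl, hb.le⟩⟩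
  have hε4 : 0 < ε / 4 := by positivity
  obtain ⟨P, hP⟩ := exists_polynomial_near hb f hε4
  set k := γ * P.eval 0 - P.derivative.eval 0
  set m := -P.derivative.derivative.eval b
  obtain ⟨A, a1, a2, a3, a4, a5, a6⟩ := exists_small_polynomial hb (ε := ε / 4 / (|k| + 1))
    (by positivity)
  obtain ⟨B, b1, b2, b3, b4, b5⟩ := exists_small_polynomial_snd' hb (ε := ε / 4 / (|m| + 1))
    (by positivity)
  refine ⟨_, polyIcc_mem_domG2 (P := P + .C k * A + .C m * B) ?_ ?_, ?_⟩
  · simp [a1, a2, b1, b2, k]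
  · simp [a5, b4, m]
  · rw [ContinuousMap.dist_lt_iff_of_nonempty]
    intro x
    have h1 := abs_mul_le_of_le_div (a6 x x.2)
    have h2 := abs_mul_le_of_le_div (b5 x x.2)
    have h3 := hP x
    rw [dist_comm, Real.dist_eq]
    have e : polyIcc 0 b (P + .C k * A + .C m * B) x - f x
        = (P.eval x.1 - f x) + k * A.eval x.1 + m * B.eval x.1 := by
      change Polynomial.eval x.1 _ - _ = _
      simp only [Polynomial.eval_add, Polynomial.eval_mul, Polynomial.eval_C]
      ring
    rw [e]
    have h4 := abs_add_three (P.eval x.1 - f x) (k * A.eval x.1) (m * B.eval x.1)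
    linarith

/-- Here the constant `P(0)` must also be removed; it is small because `f(0) = 0`. -/
lemma dense_domG1 (b : ℝ) (hb : 0 < b) : Dense (domG1 b hb : Set (C0Ioc b hb)) := by
  intro f
  rw [Metric.mem_closure_iff]
  intro ε hε
  have hne : Nonempty (Icc 0 b) := ⟨⟨0, le_rfl, hb.le⟩⟩
  have hε5 : 0 < ε / 5 := by positivity
  obtain ⟨P, hP⟩ := exists_polynomial_near hb f.1 hε5
  set k := -P.derivative.derivative.eval 0
  set m := -P.derivative.derivative.eval b
  obtain ⟨A, a1, a2, a3, a4, a5, a6, a7⟩ := exists_small_polynomial_snd hb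
    (ε := ε / 5 / (|k| + 1)) (by positivity)
  obtain ⟨B, b1, b2, b3, b4, b5⟩ := exists_small_polynomial_snd' hb (ε := ε / 5 / (|m| + 1))
    (by positivity)
  refine ⟨_, polyIcc_mem_domG1 (P := P - .C (P.eval 0) + .C k * A + .C m * B) ?_ ?_ ?_, ?_⟩
  · simp [a1, b1]
  · simp [a3, b3, k]
  · simp [a6, b4, m]
  · rw [Subtype.dist_eq, ContinuousMap.dist_lt_iff_of_nonempty]
    intro x
    have h1 := abs_mul_le_of_le_div (a7 x x.2)
    have h2 := abs_mul_le_of_le_div (b5 x x.2)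
    have h3 := hP x
    have h0 := hP ⟨0, le_rfl, hb.le⟩
    have hf0 : f.1 ⟨0, le_rfl, hb.le⟩ = 0 := f.2
    rw [hf0, sub_zero, ← abs_neg] at h0
    rw [dist_comm, Real.dist_eq]
    have e : polyIcc 0 b (P - .C (P.eval 0) + .C k * A + .C m * B) x - f.1 x
        = ((P.eval x.1 - f.1 x) + -P.eval 0) + k * A.eval x.1 + m * B.eval x.1 := by
      change Polynomial.eval x.1 _ - _ = _
      simp only [Polynomial.eval_add, Polynomial.eval_sub, Polynomial.eval_mul, Polynomial.eval_C]
      ring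
    rw [e]
    have h4 := abs_add_three ((P.eval x.1 - f.1 x) + -P.eval 0) (k * A.eval x.1) (m * B.eval x.1)
    have h5 := abs_add_le (P.eval x.1 - f.1 x) (-P.eval 0)
    linarith

/-! ### Generation by `G₁` and `G₂` -/

lemma isMDissipative_opG2 {b γ : ℝ} (hb : 0 < b) (hγ : 0 ≤ γ) : IsMDissipative (opG2 b γ hb) where
  dense_domain := dense_domG2 b γ hb
  dissipative l hl f g h := by
    obtain ⟨p, hp, h0, h1⟩ := mem_graph_opG2.1 h
    refine mul_norm_le_norm_smul_sub hb hp ?_ h1 hl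
    rw [h0]
    nlinarith [mul_nonneg hγ (mul_self_nonneg (lineExt hb.le f 0))]
  range l hl g := by
    obtain ⟨f, p, k, hp, h0, h1, h2⟩ := exists_resolvent_solution hb hl g zero_le_one hγ
      (by linarith)
    exact ⟨f, l • f - g, mem_graph_opG2.2 ⟨p, hp, by rw [h1, h0]; ring, h2⟩, sub_sub_cancel _ _⟩

lemma isMDissipative_opG1 {b : ℝ} (hb : 0 < b) : IsMDissipative (X := C0Ioc b hb) (opG1 b hb) where
  dense_domain := dense_domG1 b hb
  dissipative l hl f g h := by
    obtain ⟨p, hp, h1⟩ := mem_graph_opG1.1 h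
    refine mul_norm_le_norm_smul_sub hb hp ?_ h1 hl
    have h0 : f.1 ⟨0, le_rfl, hb.le⟩ = 0 := f.2
    rw [lineExt_of_mem _ _ (left_mem_Icc.2 hb.le), h0, zero_mul]
  range l hl g := by
    -- Data `(m, n) = (0, 1)` force `f(0) = 0`, where `(1, γ)` encodes the elastic condition of
    -- `G₂`.
    obtain ⟨f, p, k, hp, h0, -, h2⟩ := exists_resolvent_solution hb hl g.1 le_rfl zero_le_one
      (by norm_num)
    rw [mul_zero, lineExt_of_mem _ _ (left_mem_Icc.2 hb.le)] at h0
    exact ⟨⟨f, h0⟩, l • ⟨f, h0⟩ - g, mem_graph_opG1.2 ⟨p, hp, h2⟩, sub_sub_cancel _ _⟩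

instance completeSpace_C0Ioc (b : ℝ) (hb : 0 < b) : CompleteSpace (C0Ioc b hb) := by
  refine IsClosed.completeSpace_coe (s := (C0Ioc b hb : Set C(Icc 0 b, ℝ))) (hs := ?_)
  exact isClosed_eq (continuous_eval_const _) continuous_const


/-! ### Direct sums of semigroups -/

section DirectSum

variable {X Y Z : Type*} [NormedAddCommGroup X] [NormedSpace ℝ X] [NormedAddCommGroup Y]
  [NormedSpace ℝ Y] [NormedAddCommGroup Z] [NormedSpace ℝ Z]

/-- A decomposition of `X` as the direct sum of `Y` and `Z`, by projections `fst` and `snd` and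
injections `inl` and `inr`. -/
structure DirectSum₂ (X Y Z : Type*) [NormedAddCommGroup X] [NormedSpace ℝ X]
    [NormedAddCommGroup Y] [NormedSpace ℝ Y] [NormedAddCommGroup Z] [NormedSpace ℝ Z] where
  fst : X →L[ℝ] Y
  snd : X →L[ℝ] Z
  inl : Y →L[ℝ] X
  inr : Z →L[ℝ] X
  fst_inl : ∀ y, fst (inl y) = y
  fst_inr : ∀ z, fst (inr z) = 0
  snd_inl : ∀ y, snd (inl y) = 0
  snd_inr : ∀ z, snd (inr z) = z
  inl_fst_add_inr_snd : ∀ x, inl (fst x) + inr (snd x) = x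

namespace DirectSum₂

variable (e : DirectSum₂ X Y Z)

/-- The direct sum of two semigroups. -/
noncomputable def semigroup (S : C0Semigroup Y) (T : C0Semigroup Z) : C0Semigroup X where
  toFun t := e.inl ∘SL S t ∘SL e.fst + e.inr ∘SL T t ∘SL e.snd
  map_zero' := by
    ext x
    simp [S.map_zero', T.map_zero', e.inl_fst_add_inr_snd]
  map_add' s t := by
    ext x
    simp [S.map_add', T.map_add', e.fst_inl, e.fst_inr, e.snd_inl, e.snd_inr]
  continuous' x :=
    (e.inl.continuous.comp (S.continuous' _)).add (e.inr.continuous.comp (T.continuous' _))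

lemma semigroup_apply (S : C0Semigroup Y) (T : C0Semigroup Z) (t : ℝ≥0) (x : X) :
    e.semigroup S T t x = e.inl (S t (e.fst x)) + e.inr (T t (e.snd x)) := rfl

lemma tendsto_iff {ι : Type*} {l : Filter ι} {u : ι → X} {x : X} :
    Tendsto u l (𝓝 x) ↔ Tendsto (fun i => e.fst (u i)) l (𝓝 (e.fst x)) ∧
      Tendsto (fun i => e.snd (u i)) l (𝓝 (e.snd x)) := by
  refine ⟨fun h => ⟨(e.fst.continuous.tendsto x).comp h, (e.snd.continuous.tendsto x).comp h⟩,
    fun h => ?_⟩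
  have := ((e.inl.continuous.tendsto _).comp h.1).add ((e.inr.continuous.tendsto _).comp h.2)
  rw [e.inl_fst_add_inr_snd] at this
  exact this.congr fun i => e.inl_fst_add_inr_snd (u i)

variable {e} {A : X →ₗ.[ℝ] X} {B : Y →ₗ.[ℝ] Y} {C : Z →ₗ.[ℝ] Z}

/-- The components of the difference quotient of the sum are the quotients of `S` and `T`, and
convergence in `X` is convergence of both components. -/
lemma isGenerator_semigroup
    (h : ∀ x x', (x, x') ∈ A.graph ↔
      (e.fst x, e.fst x') ∈ B.graph ∧ (e.snd x, e.snd x') ∈ C.graph)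
    {S : C0Semigroup Y} {T : C0Semigroup Z} (hS : IsGenerator B S) (hT : IsGenerator C T) :
    IsGenerator A (e.semigroup S T) := fun x x' => by
  rw [h, hS, hT, e.tendsto_iff]
  simp [semigroup_apply, e.fst_inl, e.fst_inr, e.snd_inl, e.snd_inr]

lemma dense_domain
    (h : ∀ x x', (x, x') ∈ A.graph ↔
      (e.fst x, e.fst x') ∈ B.graph ∧ (e.snd x, e.snd x') ∈ C.graph)
    (hB : Dense (B.domain : Set Y)) (hC : Dense (C.domain : Set Z)) :
    Dense (A.domain : Set X) := by
  have hsurj : Function.Surjective fun p : Y × Z => e.inl p.1 + e.inr p.2 := fun x =>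
    ⟨(e.fst x, e.snd x), e.inl_fst_add_inr_snd x⟩
  have hc : Continuous fun p : Y × Z => e.inl p.1 + e.inr p.2 := by fun_prop
  refine (hsurj.denseRange.dense_image hc (hB.prod hC)).mono ?_
  rintro _ ⟨⟨y, z⟩, ⟨hy, hz⟩, rfl⟩
  have h1 := B.mem_graph ⟨y, hy⟩
  have h2 := C.mem_graph ⟨z, hz⟩
  refine LinearPMap.mem_domain_of_mem_graph (y := e.inl (B ⟨y, hy⟩) + e.inr (C ⟨z, hz⟩)) ?_
  rw [h]
  simpa [e.fst_inl, e.fst_inr, e.snd_inl, e.snd_inr] using And.intro h1 h2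

/-- The injections and projections need not be contractive, but `IsGenerator.unique` asks only for
some uniform bound. -/
lemma exists_bound_semigroup {S : C0Semigroup Y} {T : C0Semigroup Z}
    (hS : ∀ t y, ‖S t y‖ ≤ ‖y‖) (hT : ∀ t z, ‖T t z‖ ≤ ‖z‖) :
    ∃ M, ∀ t x, ‖e.semigroup S T t x‖ ≤ M * ‖x‖ := by
  refine ⟨‖e.inl‖ * ‖e.fst‖ + ‖e.inr‖ * ‖e.snd‖, fun t x => ?_⟩
  rw [semigroup_apply, add_mul, mul_assoc, mul_assoc]
  refine norm_add_le_of_le ((e.inl.le_opNorm _).trans ?_) ((e.inr.le_opNorm _).trans ?_)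
  · exact mul_le_mul_of_nonneg_left ((hS t _).trans (e.fst.le_opNorm x)) (norm_nonneg _)
  · exact mul_le_mul_of_nonneg_left ((hT t _).trans (e.snd.le_opNorm x)) (norm_nonneg _)

end DirectSum₂

end DirectSum

/-! ### The operator `A` as the direct sum of `G₁` and `G₂` -/

lemma norm_comp_reflect_le {b : ℝ} (f : C(Icc (-b) b, ℝ)) : ‖f.comp (reflect b)‖ ≤ ‖f‖ :=
  (ContinuousMap.norm_le _ (norm_nonneg _)).2 fun _ => f.norm_coe_le_norm _

lemma norm_Q1_le {b : ℝ} (f : C(Icc (-b) b, ℝ)) : ‖Q1 b f‖ ≤ 1 * ‖f‖ := by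
  change ‖(1 / 2 : ℝ) • (f - f.comp (reflect b))‖ ≤ _
  rw [norm_smul, Real.norm_of_nonneg (by norm_num)]
  linarith [norm_sub_le f (f.comp (reflect b)), norm_comp_reflect_le f]

lemma norm_Q2_le {b : ℝ} (f : C(Icc (-b) b, ℝ)) : ‖Q2 b f‖ ≤ 1 * ‖f‖ := by
  change ‖(1 / 2 : ℝ) • (f + f.comp (reflect b))‖ ≤ _
  rw [norm_smul, Real.norm_of_nonneg (by norm_num)]
  linarith [norm_add_le f (f.comp (reflect b)), norm_comp_reflect_le f]

lemma Q1_odd {b : ℝ} (f : oddSub b) : Q1 b f = f := by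
  ext x
  have := f.2 x
  simp [Q1, this]
  ring

lemma Q1_even {b : ℝ} (f : evenSub b) : Q1 b f = 0 := by
  ext x
  have := f.2 x
  simp [Q1, this]

lemma Q2_odd {b : ℝ} (f : oddSub b) : Q2 b f = 0 := by
  ext x
  have := f.2 x
  simp [Q2, this]

lemma Q2_even {b : ℝ} (f : evenSub b) : Q2 b f = f := by
  ext x
  have := f.2 x
  simp [Q2, this]
  ring

lemma Q1_add_Q2 {b : ℝ} (f : C(Icc (-b) b, ℝ)) : (Q1 b f : C(Icc (-b) b, ℝ)) + Q2 b f = f := by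
  ext x
  simp [Q1, Q2]
  ring

/-- The decomposition of `C[-b, b]` into odd and even functions. -/
noncomputable def oddEvenSum (b : ℝ) (hb : 0 < b) :
    DirectSum₂ C(Icc (-b) b, ℝ) (C0Ioc b hb) C(Icc 0 b, ℝ) where
  fst := (J1 b hb).toContinuousLinearEquiv.toContinuousLinearMap ∘SL
    (Q1 b).mkContinuous 1 norm_Q1_le
  snd := (J2 b).toContinuousLinearEquiv.toContinuousLinearMap ∘SL
    (Q2 b).mkContinuous 1 norm_Q2_le
  inl := (oddSub b).subtypeL ∘SL (J1 b hb).symm.toContinuousLinearEquiv.toContinuousLinearMap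
  inr := (evenSub b).subtypeL ∘SL (J2 b).symm.toContinuousLinearEquiv.toContinuousLinearMap
  fst_inl y := by
    change J1 b hb (Q1 b ((J1 b hb).symm y : oddSub b)) = y
    rw [Q1_odd, LinearIsometryEquiv.apply_symm_apply]
  fst_inr z := by
    change J1 b hb (Q1 b ((J2 b).symm z : evenSub b)) = 0
    rw [Q1_even, LinearIsometryEquiv.map_zero]
  snd_inl y := by
    change J2 b (Q2 b ((J1 b hb).symm y : oddSub b)) = 0
    rw [Q2_odd, LinearIsometryEquiv.map_zero]
  snd_inr z := by
    change J2 b (Q2 b ((J2 b).symm z : evenSub b)) = z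
    rw [Q2_even, LinearIsometryEquiv.apply_symm_apply]
  inl_fst_add_inr_snd x := by
    change ((J1 b hb).symm (J1 b hb (Q1 b x)) : C(Icc (-b) b, ℝ)) +
      ((J2 b).symm (J2 b (Q2 b x)) : C(Icc (-b) b, ℝ)) = x
    rw [LinearIsometryEquiv.symm_apply_apply, LinearIsometryEquiv.symm_apply_apply, Q1_add_Q2]

/-- The matching of second derivatives at `0` is absorbed by having a single `g` on both sides. -/
lemma mem_graph_opA {a b γ : ℝ} {ha : a < 0} {hb : 0 < b} {f g : C(Icc a b, ℝ)} :
    (f, g) ∈ (opA a b γ ha hb).graph ↔ ∃ p p',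
      HasTwoDerivs a 0 (lineExt (ha.trans hb).le f) p (fun x => 2 * lineExt (ha.trans hb).le g x) ∧
      HasTwoDerivs 0 b (lineExt (ha.trans hb).le f) p' (fun x => 2 * lineExt (ha.trans hb).le g x) ∧
      lineExt (ha.trans hb).le g a = 0 ∧ lineExt (ha.trans hb).le g b = 0 ∧
      p' 0 - p 0 = 2 * γ * lineExt (ha.trans hb).le f 0 := by
  have hab := (ha.trans hb).le
  have h0 : (0 : ℝ) ∈ Icc a b := ⟨ha.le, hb.le⟩
  have ha0 : a ∈ Icc a 0 := left_mem_Icc.2 ha.le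
  have h0a : 0 ∈ Icc a 0 := right_mem_Icc.2 ha.le
  have h0b : 0 ∈ Icc 0 b := left_mem_Icc.2 hb.le
  have hb0 : b ∈ Icc 0 b := right_mem_Icc.2 hb.le
  rw [LinearPMap.mem_graph_iff]
  constructor
  · rintro ⟨y, rfl, rfl⟩
    obtain ⟨y1, y2, y3, y4, y5, y6⟩ := y.2
    have e1 : ∀ x ∈ Icc a 0, lineExt hab (opA a b γ ha hb y) x
        = (1 / 2) * D2 a 0 (lineExt hab y.1) x := fun x hx => by
      rw [lineExt_of_mem _ _ ⟨hx.1, hx.2.trans hb.le⟩]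
      change (1 / 2) * D2pw a b (lineExt hab y.1) x = _
      rw [D2pw, if_pos hx.2]
    have e2 : ∀ x ∈ Icc 0 b, lineExt hab (opA a b γ ha hb y) x
        = (1 / 2) * D2 0 b (lineExt hab y.1) x := fun x hx => by
      rcases hx.1.eq_or_lt with rfl | hx0
      · rw [e1 0 h0a, y5]
      · rw [lineExt_of_mem _ _ ⟨ha.le.trans hx.1, hx.2⟩]
        change (1 / 2) * D2pw a b (lineExt hab y.1) x = _
        rw [D2pw, if_neg (not_le.2 hx0)]
    refine ⟨_, _, (HasTwoDerivs.of_contDiffOn ha y1).congr (fun _ _ => rfl) fun x hx => ?_,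
      (HasTwoDerivs.of_contDiffOn hb y2).congr (fun _ _ => rfl) fun x hx => ?_, ?_, ?_, ?_⟩
    · simp only [e1 x hx]
      ring
    · simp only [e2 x hx]
      ring
    · rw [e1 a ha0, y3, mul_zero]
    · rw [e2 b hb0, y4, mul_zero]
    · rw [lineExt_of_mem _ _ h0]
      exact y6
  · rintro ⟨p, p', h1, h2, h3, h4, h5⟩
    refine ⟨⟨f, h1.contDiffOn ha, h2.contDiffOn hb, ?_, ?_, ?_, ?_⟩, rfl, ?_⟩
    · rw [h1.D2_eq ha ha0, h3, mul_zero]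
    · rw [h2.D2_eq hb hb0, h4, mul_zero]
    · rw [h1.D2_eq ha h0a, h2.D2_eq hb h0b]
    · rw [h1.D1_eq ha h0a, h2.D1_eq hb h0b, h5, lineExt_of_mem _ _ h0]
    · ext x
      change (1 / 2) * D2pw a b (lineExt hab f) x = g x
      rw [← lineExt_apply hab]
      rcases le_or_gt x.1 0 with hx | hx
      · rw [D2pw, if_pos hx, h1.D2_eq ha ⟨x.2.1, hx⟩]
        ring
      · rw [D2pw, if_neg (not_le.2 hx), h2.D2_eq hb ⟨hx.le, x.2.2⟩]
        ring

/-- The right side has the shape produced by `HasTwoDerivs.add`, `HasTwoDerivs.const_mul` and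
`HasTwoDerivs.comp_neg`. -/
lemma lineExt_fst {b : ℝ} (hb : 0 < b) (f : C(Icc (-b) b, ℝ)) {x : ℝ} (hx : x ∈ Icc 0 b) :
    lineExt hb.le ((oddEvenSum b hb).fst f).1 x =
    1 / 2 * (lineExt (neg_lt_self hb).le f x + -1 * lineExt (neg_lt_self hb).le f (-x)) := by
  rw [lineExt_of_mem _ _ hx, lineExt_of_mem (x := x) _ _ ⟨by linarith [hx.1], hx.2⟩,
    lineExt_of_mem (x := -x) _ _ ⟨by linarith [hx.2], by linarith [hx.1]⟩, neg_one_mul,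
    ← sub_eq_add_neg]
  rfl

lemma lineExt_snd {b : ℝ} (hb : 0 < b) (f : C(Icc (-b) b, ℝ)) {x : ℝ} (hx : x ∈ Icc 0 b) :
    lineExt hb.le ((oddEvenSum b hb).snd f) x =
    1 / 2 * (lineExt (neg_lt_self hb).le f x + lineExt (neg_lt_self hb).le f (-x)) := by
  rw [lineExt_of_mem _ _ hx, lineExt_of_mem (x := x) _ _ ⟨by linarith [hx.1], hx.2⟩,
    lineExt_of_mem (x := -x) _ _ ⟨by linarith [hx.2], by linarith [hx.1]⟩]
  rfl

lemma lineExt_eq_fst_add_snd {b : ℝ} (hb : 0 < b) (f : C(Icc (-b) b, ℝ)) {x : ℝ} (hx : x ∈ Icc 0 b) :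
    lineExt (neg_lt_self hb).le f x =
    lineExt hb.le ((oddEvenSum b hb).fst f).1 x + lineExt hb.le ((oddEvenSum b hb).snd f) x := by
  rw [lineExt_fst hb f hx, lineExt_snd hb f hx]
  ring

lemma lineExt_neg_eq_snd_sub_fst {b : ℝ} (hb : 0 < b) (f : C(Icc (-b) b, ℝ)) {x : ℝ} (hx : x ∈ Icc 0 b) :
    lineExt (neg_lt_self hb).le f (-x) =
    -1 * lineExt hb.le ((oddEvenSum b hb).fst f).1 x + lineExt hb.le ((oddEvenSum b hb).snd f) x := by
  rw [lineExt_fst hb f hx, lineExt_snd hb f hx]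
  ring

/-- Taking odd and even parts commutes with `½ f''`, so only the boundary and transmission
conditions have to be matched. This is where the symmetry of the interval enters. -/
lemma mem_graph_opA_iff {b γ : ℝ} (hb : 0 < b) (f g : C(Icc (-b) b, ℝ)) :
    (f, g) ∈ (opA (-b) b γ (neg_lt_zero.2 hb) hb).graph ↔
      ((oddEvenSum b hb).fst f, (oddEvenSum b hb).fst g) ∈ (opG1 b hb).graph ∧
      ((oddEvenSum b hb).snd f, (oddEvenSum b hb).snd g) ∈ (opG2 b γ hb).graph := by
  have h0 : 0 ∈ Icc 0 b := left_mem_Icc.2 hb.le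
  have hb0 : b ∈ Icc 0 b := right_mem_Icc.2 hb.le
  rw [mem_graph_opA, mem_graph_opG1, mem_graph_opG2]
  constructor
  · rintro ⟨p, p', h1, h2, h3, h4, h5⟩
    have h1' := h1.comp_neg
    rw [neg_zero, neg_neg] at h1'
    refine ⟨⟨_, ((h2.add (h1'.const_mul (-1))).const_mul (1 / 2)).congr
      (fun x hx => lineExt_fst hb f hx) fun x hx => ?_, ?_⟩,
      ⟨_, ((h2.add h1').const_mul (1 / 2)).congr
      (fun x hx => lineExt_snd hb f hx) fun x hx => ?_, ?_, ?_⟩⟩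
    · simp only [lineExt_fst hb g hx]
      ring
    · rw [lineExt_fst hb g hb0, h3, h4]
      norm_num
    · simp only [lineExt_snd hb g hx]
      ring
    -- The even part has slope `½ (p' 0 - p 0)` at `0`, half of the jump `2 γ f(0)`.
    · simp only [lineExt_snd hb f h0, neg_zero]
      linarith
    · rw [lineExt_snd hb g hb0, h3, h4]
      norm_num
  · rintro ⟨⟨p, h1, h2⟩, ⟨p', h3, h4, h5⟩⟩
    -- On the left half, `f` is the reflection of the even part minus the odd part.
    have h6 := ((h1.const_mul (-1)).add h3).comp_neg
    rw [neg_zero] at h6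
    have hm : ∀ x ∈ Icc (-b) 0, -x ∈ Icc 0 b := fun x hx =>
      ⟨by linarith [hx.2], by linarith [hx.1]⟩
    have e : ∀ (f : C(Icc (-b) b, ℝ)), ∀ x ∈ Icc (-b) 0, lineExt (neg_lt_self hb).le f x =
        -1 * lineExt hb.le ((oddEvenSum b hb).fst f).1 (-x) +
          lineExt hb.le ((oddEvenSum b hb).snd f) (-x) := fun f x hx => by
      rw [← lineExt_neg_eq_snd_sub_fst hb f (hm x hx), neg_neg]
    refine ⟨_, _, h6.congr (e f) fun x hx => ?_, (h1.add h3).congr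
      (fun x hx => lineExt_eq_fst_add_snd hb f hx) fun x hx => ?_, ?_, ?_, ?_⟩
    · simp only [e g x hx]
      ring
    · simp only [lineExt_eq_fst_add_snd hb g hx]
      ring
    · rw [lineExt_neg_eq_snd_sub_fst hb g hb0, h2, h5]
      norm_num
    · rw [lineExt_eq_fst_add_snd hb g hb0, h2, h5]
      norm_num
    · have h7 : lineExt (neg_lt_self hb).le f 0 = lineExt hb.le ((oddEvenSum b hb).snd f) 0 := by
        rw [lineExt_snd hb f h0, neg_zero]
        ring
      rw [h7]
      simp only [neg_zero]
      -- The one-sided slopes are `p 0 + p' 0` and `p 0 - p' 0`, so the jump is `2 p' 0`.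
      linarith


lemma isGenerator_opA {b γ : ℝ} (hb : 0 < b) {S₁ : C0Semigroup (C0Ioc b hb)}
    {S₂ : C0Semigroup C(Icc 0 b, ℝ)} (h₁ : IsGenerator (opG1 b hb) S₁)
    (h₂ : IsGenerator (opG2 b γ hb) S₂) :
    IsGenerator (opA (-b) b γ (neg_lt_zero.2 hb) hb) ((oddEvenSum b hb).semigroup S₁ S₂) :=
  DirectSum₂.isGenerator_semigroup (e := oddEvenSum b hb) (B := opG1 b hb) (C := opG2 b γ hb)
    (fun f g => mem_graph_opA_iff hb f g) h₁ h₂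

lemma dense_domA (b γ : ℝ) (hb : 0 < b) :
    Dense (domA (-b) b γ (neg_lt_zero.2 hb) hb : Set C(Icc (-b) b, ℝ)) :=
  DirectSum₂.dense_domain (e := oddEvenSum b hb) (A := opA (-b) b γ (neg_lt_zero.2 hb) hb)
    (B := opG1 b hb) (C := opG2 b γ hb) (fun f g => mem_graph_opA_iff hb f g)
    (dense_domG1 b hb) (dense_domG2 b γ hb)

lemma exists_semigroup_opG1 {b : ℝ} (hb : 0 < b) :
    ∃ T : C0Semigroup (C0Ioc b hb), IsGenerator (opG1 b hb) T ∧ (∀ t f, ‖T t f‖ ≤ ‖f‖) ∧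
      ∀ S, IsGenerator (opG1 b hb) S → ∀ t f, S t f = T t f := by
  obtain ⟨T, hT, hle⟩ := (isMDissipative_opG1 hb).exists_semigroup
  exact ⟨T, hT, hle, fun S hS => hS.unique hT (dense_domG1 b hb) (M := 1)
    fun t f => (hle t f).trans (one_mul _).ge⟩

lemma exists_semigroup_opG2 {b γ : ℝ} (hb : 0 < b) (hγ : 0 ≤ γ) :
    ∃ T : C0Semigroup C(Icc 0 b, ℝ), IsGenerator (opG2 b γ hb) T ∧ (∀ t f, ‖T t f‖ ≤ ‖f‖) ∧
      ∀ S, IsGenerator (opG2 b γ hb) S → ∀ t f, S t f = T t f := by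
  obtain ⟨T, hT, hle⟩ := (isMDissipative_opG2 hb hγ).exists_semigroup
  exact ⟨T, hT, hle, fun S hS => hS.unique hT (dense_domG2 b γ hb) (M := 1)
    fun t f => (hle t f).trans (one_mul _).ge⟩

lemma oddEvenSum_semigroup_apply {b : ℝ} (hb : 0 < b) (S₁ : C0Semigroup (C0Ioc b hb))
    (S₂ : C0Semigroup C(Icc 0 b, ℝ)) (t : ℝ≥0) (f : C(Icc (-b) b, ℝ)) :
    (oddEvenSum b hb).semigroup S₁ S₂ t f =
      ((J1 b hb).symm (S₁ t (J1 b hb (Q1 b f))) : C(Icc (-b) b, ℝ)) +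
        ((J2 b).symm (S₂ t (J2 b (Q2 b f))) : C(Icc (-b) b, ℝ)) := rfl

end ElasticBM

/-! ### Assembly of the theorem. -/

open ElasticBM
theorem mainTheorem4 (b γ : ℝ) (hb : 0 < b) (hγ : 0 ≤ γ) :
    (∃ S : C0Semigroup C(Icc (-b) b, ℝ), IsGenerator (opA (-b) b γ (neg_lt_zero.2 hb) hb) S) ∧
    (∃ S₁ : C0Semigroup (C0Ioc b hb), IsGenerator (opG1 b hb) S₁) ∧
    (∃ S₂ : C0Semigroup C(Icc 0 b, ℝ), IsGenerator (opG2 b γ hb) S₂) ∧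
    ∀ (S : C0Semigroup C(Icc (-b) b, ℝ)) (S₁ : C0Semigroup (C0Ioc b hb))
      (S₂ : C0Semigroup C(Icc 0 b, ℝ)),
      IsGenerator (opA (-b) b γ (neg_lt_zero.2 hb) hb) S →
      IsGenerator (opG1 b hb) S₁ →
      IsGenerator (opG2 b γ hb) S₂ →
      ∀ (t : ℝ≥0) (f : C(Icc (-b) b, ℝ)),
        S t f = ((J1 b hb).symm (S₁ t (J1 b hb (Q1 b f))) : C(Icc (-b) b, ℝ)) +
          ((J2 b).symm (S₂ t (J2 b (Q2 b f))) : C(Icc (-b) b, ℝ)) := by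
  obtain ⟨T₁, hT₁, hb₁, hu₁⟩ := exists_semigroup_opG1 hb
  obtain ⟨T₂, hT₂, hb₂, hu₂⟩ := exists_semigroup_opG2 hb hγ
  have hT := isGenerator_opA hb hT₁ hT₂
  obtain ⟨M, hM⟩ := (oddEvenSum b hb).exists_bound_semigroup hb₁ hb₂
  refine ⟨⟨_, hT⟩, ⟨T₁, hT₁⟩, ⟨T₂, hT₂⟩, fun S S₁ S₂ hS hS₁ hS₂ t f => ?_⟩
  -- Uniqueness replaces all three given semigroups by the constructed ones, for which the formula
  -- is the definition.
  rw [hS.unique hT (dense_domA b γ hb) hM, hu₁ S₁ hS₁, hu₂ S₂ hS₂, oddEvenSum_semigroup_apply]
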